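/- **Notation and setting.** $\mathbb R_+=[0,\infty)$; $\mathcal K$ is the class of continuous strictly increasing $\alpha:\mathbb R_+\to\mathbb R_+$ with $\alpha(0)=0$; $\mathcal K_\infty$ is the class of unbounded $\alpha\in\mathcal K$; $\mathcal{KL}$ is the class of $\beta:\mathbb R_+\times\mathbb R_+\to\mathbb R_+$ such that $\beta(\cdot,t)\in\mathcal K$ for every $t\ge 0$ and, for every $s>0$, $\beta(s,\cdot)$ is continuous, strictly decreasing and tends to $0$. A continuous $\rho:\mathbb R_+\to\mathbb R_+$ is positive definite if $\rho(0)=0$ and $\rho(s)>0$ for $s>0$. Let $n=n_1+\dots+n_N$, let $|\cdot|$ denote a fixed monotonic norm on $\mathbb R^n=\mathbb R^{n_1}\times\dots\times\mathbb R^{n_N}$ and one on $\mathbb R^m$ (monotonic: $|v|\le|w|$ whenever $0\le v\le w$ componentwise), and for $x_i\in\mathbb R^{n_i}$ put $|x_i|:=|(0,\dots,0,x_i,0,\dots,0)|$. For $u:\mathbb N\to\mathbb R^m$ put $\|u\|:=\sup_{k}|u(k)|$, and $u\in l^\infty$ if $\|u\|<\infty$. Consider subsystems $x_i(k+1)=g_i(x_1(k),\dots,x_N(k),u(k))$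 with $g_i:\mathbb R^{n}\times\mathbb R^m\to\mathbb R^{n_i}$, $i=1,\dots,N$, and the overall system $$x(k+1)=G(x(k),u(k)),\quad k\in\mathbb N,\qquad G=(g_1,\dots,g_N):\mathbb R^n\times\mathbb R^m\to\mathbb R^n,\tag{1}$$ with solutions $x(k,\xi,u)=(x_1(k,\xi,u),\dots,x_N(k,\xi,u))$, $x(0,\xi,u)=\xi$. Assume that $G$ is globally $\mathcal K$-bounded: there are $\omega_1,\omega_2\in\mathcal K$ with $|G(\xi,\mu)|\le\omega_1(|\xi|)+\omega_2(|\mu|)$ for all $\xi,\mu$ ($G$ need not be continuous). * System (1) is *ISS* if there are $\beta\in\mathcal{KL}$, $\gamma\in\mathcal K$ with $|x(k,\xi,u)|\le\beta(|\xi|,k)+\gamma(\|u\|)$ for all $\xi\in\mathbb R^n$, $u\in l^\infty$, $k\in\mathbb N$. * A function $W$ with values in $\mathbb R_+$ is *proper and positive definite* if $\alpha_1(|\xi|)\le W(\xi)\le\alpha_2(|\xi|)$ for all $\xi$, for some $\alpha_1,\alpha_2\in\mathcal K_\infty$. * A proper and positive definite $V:\mathbb R^n\to\mathbb R_+$ is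 a *dissipative finite-step ISS Lyapunov function* for (1) if there are $M'\in\mathbb N$, $M'\ge1$, $\sigma\in\mathcal K$ and a positive definite $\rho$ with $\mathrm{id}-\rho\in\mathcal K_\infty$ such that $V(x(M',\xi,u))\le\rho(V(\xi))+\sigma(\|u\|)$ for all $\xi\in\mathbb R^n$, $u\in l^\infty$. * For $T:\mathbb R^N_+\to\mathbb R^N_+$ write $T\not\ge\mathrm{id}$ if for every $s\in\mathbb R^N_+\setminus\{0\}$ there is $i$ with $[T(s)]_i<[s]_i$. * $\tilde\sigma=(\tilde\sigma_1,\dots,\tilde\sigma_N)\in\mathcal K_\infty^N$ is an *$\Omega$-path* for $T$ if every $\tilde\sigma_i^{-1}$ is locally Lipschitz on $(0,\infty)$; for every compact $K\subset(0,\infty)$ there are $0<c<C$ with $c\le(\tilde\sigma_i^{-1})'(r)\le C$ for all $i$ and all points $r\in K$ at which $\tilde\sigma_i^{-1}$ is differentiable; and $[T(\tilde\sigma(r))]_i<\tilde\sigma_i(r)$ for all $r>0$ and all $i$. **Theorem.** Let $\delta_i,\delta_{i1},\delta_{i2}\in\mathcal K_\infty$, $d_i=\mathrm{id}+\delta_i$,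 $d_{ij}=\mathrm{id}+\delta_{ij}$ $(j=1,2)$, and let the diagonal operators $D=\mathrm{diag}(d_i)$, $D_j=\mathrm{diag}(d_{ij})$ on $\mathbb R_+^N$ satisfy $D=D_2\circ D_1$. Assume that there are $M\in\mathbb N$, $M\ge1$, functions $V_i:\mathbb R^{n_i}\to\mathbb R_+$, $\gamma_{ij}\in\mathcal K_\infty\cup\{0\}$ and $\gamma_{iu}\in\mathcal K\cup\{0\}$, $i,j\in\{1,\dots,N\}$, such that with $[\Gamma_\oplus(s)]_i:=\max_j\gamma_{ij}([s]_j)$: 1. every $V_i$ is proper and positive definite; 2. for all $\xi=(\xi_1,\dots,\xi_N)\in\mathbb R^n$, $u\in l^\infty$ and $i\in\{1,\dots,N\}$, $$V_i(x_i(M,\xi,u))\le\big[\Gamma_\oplus(V_1(\xi_1),\dots,V_N(\xi_N))\big]_i+\gamma_{iu}(\|u\|);$$ 3. the strong small-gain condition $D\circ\Gamma_\oplus\not\ge\mathrm{id}$ holds. Then there exists an $\Omega$-path for $D_1\circ\Gamma_\oplus\circ D_2$. Moreover, for every $\Omega$-path $\tilde\sigma$ for $D_1\circ\Gamma_\oplus\circ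 D_2$: if for every $i$ there is $\hat\alpha_i\in\mathcal K_\infty$ with $\tilde\sigma_i^{-1}\circ d_{i2}^{-1}\circ\tilde\sigma_i=\mathrm{id}-\hat\alpha_i$, then $$V(\xi):=\max_i\,(\tilde\sigma_i^{-1}\circ d_{i2}^{-1})(V_i(\xi_i))$$ is a dissipative finite-step ISS Lyapunov function for (1), and in particular (1) is ISS. -/

import Mathlib

open scoped NNReal
open Filter Topology

namespace FiniteStepISS

/-! ### Comparison functions on `ℝ₊ = ℝ≥0` -/

/-- Class `K`: continuous, strictly increasing, zero at zero. -/
structure IsClassK (α : ℝ≥0 → ℝ≥0) : Prop where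
  zero : α 0 = 0
  cont : Continuous α
  strictMono : StrictMono α

/-- Class `K∞`: unbounded functions of class `K`. -/
structure IsClassKInf (α : ℝ≥0 → ℝ≥0) : Prop extends IsClassK α where
  tendsto : Tendsto α atTop atTop

/-- Class `L`: continuous, strictly decreasing, tending to zero. -/
structure IsClassL (φ : ℝ≥0 → ℝ≥0) : Prop where
  cont : Continuous φ
  strictAnti : StrictAnti φ
  tendsto : Tendsto φ atTop (𝓝 0)

/-- Class `KL`. -/
structure IsClassKL (β : ℝ≥0 → ℝ≥0 → ℝ≥0) : Prop where
  classK : ∀ t, IsClassK (fun s => β s t)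
  classL : ∀ s, 0 < s → IsClassL (β s)

/-- Positive definite functions `ℝ₊ → ℝ₊`. -/
structure IsPosDefFun (η : ℝ≥0 → ℝ≥0) : Prop where
  cont : Continuous η
  zero : η 0 = 0
  pos : ∀ s, 0 < s → 0 < η s

/-- A `K∞` function is a bijection of `ℝ₊`, so that `Function.invFun` is its inverse. -/
theorem IsClassKInf.bijective {α : ℝ≥0 → ℝ≥0} (h : IsClassKInf α) : Function.Bijective α := by
  refine ⟨h.strictMono.injective, fun y => ?_⟩
  obtain ⟨b, hb⟩ := (h.tendsto.eventually_ge_atTop y).exists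
  obtain ⟨x, -, hx⟩ := intermediate_value_Icc (zero_le) h.cont.continuousOn
    (show y ∈ Set.Icc (α 0) (α b) from ⟨by rw [h.zero]; exact zero_le, hb⟩)
  exact ⟨x, hx⟩

/-- The inverse of a function of class `K∞`. -/
noncomputable def inv (α : ℝ≥0 → ℝ≥0) : ℝ≥0 → ℝ≥0 := Function.invFun α

theorem IsClassKInf.inv_apply {α : ℝ≥0 → ℝ≥0} (h : IsClassKInf α) (s : ℝ≥0) :
    inv α (α s) = s := Function.leftInverse_invFun h.bijective.1 s

theorem IsClassKInf.apply_inv {α : ℝ≥0 → ℝ≥0} (h : IsClassKInf α) (s : ℝ≥0) :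
    α (inv α s) = s := Function.rightInverse_invFun h.bijective.2 s

/-! ### Norms -/

/-- `p` is a monotonic norm: definite, and monotone on the nonnegative orthant. -/
structure IsMonotonicNorm {E : Type*} [AddCommGroup E] [Module ℝ E] [PartialOrder E]
    (p : Seminorm ℝ E) : Prop where
  definite : ∀ x, p x = 0 → x = 0
  mono : ∀ v w, 0 ≤ v → v ≤ w → p v ≤ p w

/-- The value `p x` as an element of `ℝ₊`. -/
noncomputable def nrm {E : Type*} [AddCommGroup E] [Module ℝ E] (p : Seminorm ℝ E) (x : E) :
    ℝ≥0 := ⟨p x, apply_nonneg p x⟩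

/-- `u ∈ l^∞`. -/
def IsBoundedInput {U : Type*} [AddCommGroup U] [Module ℝ U] (p : Seminorm ℝ U) (u : ℕ → U) :
    Prop := BddAbove (Set.range fun k => nrm p (u k))

/-- The supremum norm `sup_k |u k|` of a bounded input. -/
noncomputable def supNrm {U : Type*} [AddCommGroup U] [Module ℝ U] (p : Seminorm ℝ U)
    (u : ℕ → U) : ℝ≥0 := ⨆ k, nrm p (u k)

/-! ### Discrete-time systems, input-to-state stability, Lyapunov functions -/

/-- The solution of `x (k + 1) = G (x k) (u k)`, `x 0 = ξ`, at time `k`. -/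
def solution {X U : Type*} (G : X → U → X) (ξ : X) (u : ℕ → U) : ℕ → X
  | 0 => ξ
  | k + 1 => G (solution G ξ u k) (u k)

section System

variable {X U : Type*} [AddCommGroup X] [Module ℝ X] [AddCommGroup U] [Module ℝ U]

/-- Global `K`-boundedness of `G`. -/
def GloballyKBounded (pX : Seminorm ℝ X) (pU : Seminorm ℝ U) (G : X → U → X) : Prop :=
  ∃ ω₁ ω₂ : ℝ≥0 → ℝ≥0, IsClassK ω₁ ∧ IsClassK ω₂ ∧
    ∀ ξ μ, nrm pX (G ξ μ) ≤ ω₁ (nrm pX ξ) + ω₂ (nrm pU μ)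

/-- Input-to-state stability of `x (k + 1) = G (x k) (u k)`. -/
def IsISS (pX : Seminorm ℝ X) (pU : Seminorm ℝ U) (G : X → U → X) : Prop :=
  ∃ (β : ℝ≥0 → ℝ≥0 → ℝ≥0) (γ : ℝ≥0 → ℝ≥0), IsClassKL β ∧ IsClassK γ ∧
    ∀ (ξ : X) (u : ℕ → U), IsBoundedInput pU u → ∀ k : ℕ,
      nrm pX (solution G ξ u k) ≤ β (nrm pX ξ) (k : ℝ≥0) + γ (supNrm pU u)

/-- `W` is proper and positive definite with respect to the size function `size`. -/
def IsProperPosDef {E : Type*} (size : E → ℝ≥0) (W : E → ℝ≥0) : Prop :=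
  ∃ α₁ α₂ : ℝ≥0 → ℝ≥0, IsClassKInf α₁ ∧ IsClassKInf α₂ ∧
    ∀ ξ, α₁ (size ξ) ≤ W ξ ∧ W ξ ≤ α₂ (size ξ)

/-- `V` is a dissipative finite-step ISS Lyapunov function. Since subtraction on `ℝ≥0` is
truncated, the requirement that `id - ρ` is of class `K∞` is written as `ρ + α = id` with `α` of
class `K∞`. -/
def IsDissipativeFiniteStepISSLyapunov (pX : Seminorm ℝ X) (pU : Seminorm ℝ U) (G : X → U → X)
    (V : X → ℝ≥0) : Prop :=
  IsProperPosDef (nrm pX) V ∧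
  ∃ (M : ℕ) (σ ρ : ℝ≥0 → ℝ≥0), 1 ≤ M ∧ IsClassK σ ∧ IsPosDefFun ρ ∧
    (∃ α : ℝ≥0 → ℝ≥0, IsClassKInf α ∧ ∀ s, ρ s + α s = s) ∧
    ∀ (ξ : X) (u : ℕ → U), IsBoundedInput pU u →
      V (solution G ξ u M) ≤ ρ (V ξ) + σ (supNrm pU u)

end System

/-! ### Interconnections -/

/-- The state space `ℝ^{n_1} × ⋯ × ℝ^{n_N}` of the overall system. -/
abbrev State {N : ℕ} (n : Fin N → ℕ) : Type := (i : Fin N) → Fin (n i) → ℝ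

/-- The right-hand side `G = (g_1, …, g_N)` of the overall system. -/
def overall {N : ℕ} {n : Fin N → ℕ} {U : Type*} (g : (i : Fin N) → State n → U → Fin (n i) → ℝ) :
    State n → U → State n :=
  fun x μ i => g i x μ

/-- The size `|x_i| = |(0, …, 0, x_i, 0, …, 0)|` of the `i`th component. -/
noncomputable def blockNrm {N : ℕ} {n : Fin N → ℕ} (p : Seminorm ℝ (State n)) (i : Fin N)
    (y : Fin (n i) → ℝ) : ℝ≥0 :=
  nrm p (Pi.single i y)

/-! ### Gain maps, small-gain conditions, `Ω`-paths -/

/-- The map `Γ_⊕`, with `i`th component `max_j γ_ij (s_j)`. -/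
noncomputable def gainMap {N : ℕ} (γ : Fin N → Fin N → ℝ≥0 → ℝ≥0) (s : Fin N → ℝ≥0) :
    Fin N → ℝ≥0 :=
  fun i => Finset.univ.sup fun j => γ i j (s j)

/-- The function `id + δ`. -/
noncomputable def idAdd (δ : ℝ≥0 → ℝ≥0) : ℝ≥0 → ℝ≥0 := fun r => r + δ r

theorem IsClassKInf.idAdd {δ : ℝ≥0 → ℝ≥0} (h : IsClassKInf δ) : IsClassKInf (idAdd δ) where
  zero := by simp [FiniteStepISS.idAdd, h.zero]
  cont := continuous_id.add h.cont
  strictMono := strictMono_id.add h.strictMono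
  tendsto := tendsto_atTop_mono (fun r => le_self_add) tendsto_id

/-- The diagonal operator `diag (id + δ_i)`. -/
noncomputable def diagOp {N : ℕ} (δ : Fin N → ℝ≥0 → ℝ≥0) (s : Fin N → ℝ≥0) : Fin N → ℝ≥0 :=
  fun i => idAdd (δ i) (s i)

/-- `T ≱ id`: for every `s ≠ 0` some component of `T s` is smaller than that of `s`. -/
def NotGeId {N : ℕ} (T : (Fin N → ℝ≥0) → Fin N → ℝ≥0) : Prop :=
  ∀ s, s ≠ 0 → ∃ i, T s i < s i

/-- The inverse of `α`, as a function of a real variable (it is only used on `(0, ∞)`). -/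
noncomputable def realInv (α : ℝ≥0 → ℝ≥0) : ℝ → ℝ := fun r => (inv α r.toNNReal : ℝ)

/-- `σ = (σ_1, …, σ_N)` is an `Ω`-path with respect to `T`: its components are of class `K∞`, their
inverses are locally Lipschitz on `(0, ∞)`, with derivatives bounded and bounded away from zero on
compact subsets of `(0, ∞)`, and `T (σ r) < σ r` for `r > 0`. -/
structure IsOmegaPath {N : ℕ} (T : (Fin N → ℝ≥0) → Fin N → ℝ≥0) (σ : Fin N → ℝ≥0 → ℝ≥0) :
    Prop where
  classKInf : ∀ i, IsClassKInf (σ i)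
  locallyLipschitz : ∀ i, LocallyLipschitzOn (Set.Ioi 0) (realInv (σ i))
  deriv_bounds : ∀ K : Set ℝ, IsCompact K → K ⊆ Set.Ioi 0 → ∃ c C : ℝ, 0 < c ∧ c < C ∧
    ∀ i, ∀ r ∈ K, DifferentiableAt ℝ (realInv (σ i)) r →
      c ≤ deriv (realInv (σ i)) r ∧ deriv (realInv (σ i)) r ≤ C
  decay : ∀ r, 0 < r → ∀ i, T (fun j => σ j r) i < σ i r

/-- The function `V ξ = max_i (σ_i⁻¹ ∘ (id + δ_i)⁻¹) (V_i ξ_i)`. -/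
noncomputable def compositeLyapunov {N : ℕ} {n : Fin N → ℕ} (σ δ : Fin N → ℝ≥0 → ℝ≥0)
    (V : (i : Fin N) → (Fin (n i) → ℝ) → ℝ≥0) (ξ : State n) : ℝ≥0 :=
  Finset.univ.sup fun i => inv (σ i) (inv (idAdd (δ i)) (V i (ξ i)))

end FiniteStepISS

open FiniteStepISS

/-! Existence of the path. Cancelling `D₂` turns the strong small-gain condition into the small-gain
condition for `T = D₁ ∘ Γ ∘ D₂`, again a maximum of gains `μ i j`, each of class `K∞` or zero. In
terms of the inverses `h i` of the path components, the decay of `T` along the path says `h i (μ i j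
x) < h j x` for all `x > 0`: the `h i` are potentials decreasing along every gain. Continuous
potentials `g` come from eliminating one node at a time (`exists_potential`). The strict inequality
leaves room below each `g j`, and `exists_bilipschitz_between` uses it to insert a locally
bi-Lipschitz function, the mean of an upper bound over a moving window.

Lyapunov function. If `r` is the value of the composite function at `ξ`, then `V j (ξ j) ≤ d_j2 (σ j
r)` for all `j`. Weakening the sum of gain and input to a maximum costs one factor `d_i1`, which the
path absorbs. After `M` steps the value is therefore at most the maximum of `(σ i)⁻¹ (d_i2⁻¹ (σ i
r))` over `i` and an input term; the assumption on these conjugates gives a common `ρ` with `id - ρ`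
of class `K∞`.

ISS follows from this maximum form (`isISS_of_finiteStep_max`): inputs do not accumulate under
iteration, the iterates of `ρ` tend to zero and are dominated by a `KL` function, and global
`K`-boundedness controls the times between multiples of `M`. -/

namespace FiniteStepISS

/-! ### Calculus of comparison functions -/

/-- Continuous nondecreasing functions on `ℝ₊` vanishing at zero. -/
structure IsWeakK (α : ℝ≥0 → ℝ≥0) : Prop where
  zero : α 0 = 0
  cont : Continuous α
  mono : Monotone α

theorem IsClassK.weak {α : ℝ≥0 → ℝ≥0} (h : IsClassK α) : IsWeakK α :=
  ⟨h.zero, h.cont, h.strictMono.monotone⟩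

theorem IsClassKInf.weak {α : ℝ≥0 → ℝ≥0} (h : IsClassKInf α) : IsWeakK α :=
  h.toIsClassK.weak

theorem isWeakK_zero : IsWeakK (0 : ℝ≥0 → ℝ≥0) :=
  ⟨rfl, continuous_const, monotone_const⟩

theorem isClassKInf_id : IsClassKInf (fun r => r) :=
  ⟨⟨rfl, continuous_id, strictMono_id⟩, tendsto_id⟩

theorem IsWeakK.comp {α β : ℝ≥0 → ℝ≥0} (hα : IsWeakK α) (hβ : IsWeakK β) :
    IsWeakK (fun r => α (β r)) :=
  ⟨by simp [hα.zero, hβ.zero], hα.cont.comp hβ.cont, hα.mono.comp hβ.mono⟩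

theorem IsWeakK.add {α β : ℝ≥0 → ℝ≥0} (hα : IsWeakK α) (hβ : IsWeakK β) :
    IsWeakK (fun r => α r + β r) :=
  ⟨by simp [hα.zero, hβ.zero], hα.cont.add hβ.cont, hα.mono.add hβ.mono⟩

theorem IsWeakK.finsetSup {ι : Type*} (S : Finset ι) {α : ι → ℝ≥0 → ℝ≥0}
    (hα : ∀ i, IsWeakK (α i)) : IsWeakK (fun r => S.sup fun i => α i r) where
  zero := by
    refine le_antisymm (Finset.sup_le fun i _ => ?_) zero_le
    simp [(hα i).zero]
  cont := Continuous.finset_sup_apply (s := S) fun i _ => (hα i).cont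
  mono := fun _ _ h => Finset.sup_mono_fun fun i _ => (hα i).mono h

theorem IsClassK.pos {α : ℝ≥0 → ℝ≥0} (h : IsClassK α) {r : ℝ≥0} (hr : 0 < r) : 0 < α r := by
  simpa [h.zero] using h.strictMono hr

theorem IsClassK.comp {α β : ℝ≥0 → ℝ≥0} (hα : IsClassK α) (hβ : IsClassK β) :
    IsClassK (fun r => α (β r)) :=
  ⟨by simp [hα.zero, hβ.zero], hα.cont.comp hβ.cont, hα.strictMono.comp hβ.strictMono⟩

theorem IsClassK.add_weak {α β : ℝ≥0 → ℝ≥0} (hα : IsClassK α) (hβ : IsWeakK β) :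
    IsClassK (fun r => α r + β r) :=
  ⟨by simp [hα.zero, hβ.zero], hα.cont.add hβ.cont, hα.strictMono.add_monotone hβ.mono⟩

theorem IsClassKInf.comp {α β : ℝ≥0 → ℝ≥0} (hα : IsClassKInf α) (hβ : IsClassKInf β) :
    IsClassKInf (fun r => α (β r)) :=
  ⟨hα.toIsClassK.comp hβ.toIsClassK, hα.tendsto.comp hβ.tendsto⟩

theorem IsClassKInf.add_weak {α β : ℝ≥0 → ℝ≥0} (hα : IsClassKInf α) (hβ : IsWeakK β) :
    IsClassKInf (fun r => α r + β r) :=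
  ⟨hα.toIsClassK.add_weak hβ, tendsto_atTop_mono (fun _ => le_self_add) hα.tendsto⟩

theorem IsClassKInf.max {α β : ℝ≥0 → ℝ≥0} (hα : IsClassKInf α) (hβ : IsClassKInf β) :
    IsClassKInf (fun r => max (α r) (β r)) :=
  ⟨⟨by simp [hα.zero, hβ.zero], hα.cont.max hβ.cont, fun _ _ h =>
    max_lt_max (hα.strictMono h) (hβ.strictMono h)⟩,
    tendsto_atTop_mono (fun _ => le_max_left _ _) hα.tendsto⟩

theorem IsClassKInf.min {α β : ℝ≥0 → ℝ≥0} (hα : IsClassKInf α) (hβ : IsClassKInf β) :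
    IsClassKInf (fun r => min (α r) (β r)) where
  zero := by simp [hα.zero, hβ.zero]
  cont := hα.cont.min hβ.cont
  strictMono := fun _ _ h => min_lt_min (hα.strictMono h) (hβ.strictMono h)
  tendsto := tendsto_atTop.2 fun b => by
    filter_upwards [hα.tendsto.eventually_ge_atTop b, hβ.tendsto.eventually_ge_atTop b]
      with r h1 h2 using le_min h1 h2

theorem isClassKInf_mul {c : ℝ≥0} (hc : 0 < c) : IsClassKInf (fun r => c * r) :=
  ⟨⟨by simp, continuous_const.mul continuous_id, fun _ _ h => mul_lt_mul_of_pos_left h hc⟩,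
    tendsto_id.const_mul_atTop hc⟩

theorem IsClassKInf.strictMono_inv {α : ℝ≥0 → ℝ≥0} (h : IsClassKInf α) : StrictMono (inv α) :=
  fun x y hxy => by
    rw [← h.strictMono.lt_iff_lt, h.apply_inv, h.apply_inv]; exact hxy

theorem IsClassKInf.inv {α : ℝ≥0 → ℝ≥0} (h : IsClassKInf α) : IsClassKInf (inv α) where
  zero := by simpa [h.zero] using h.inv_apply 0
  cont := h.strictMono_inv.monotone.continuous_of_surjective fun y => ⟨α y, h.inv_apply y⟩
  strictMono := h.strictMono_inv
  tendsto := h.strictMono_inv.monotone.tendsto_atTop_atTop fun b => ⟨α b, (h.inv_apply b).ge⟩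

theorem IsClassKInf.inv_inv {α : ℝ≥0 → ℝ≥0} (h : IsClassKInf α) :
    FiniteStepISS.inv (FiniteStepISS.inv α) = α := by
  funext x
  exact h.inv.strictMono.injective (by rw [h.inv.apply_inv, h.inv_apply])

theorem IsClassKInf.lt_inv_iff {α : ℝ≥0 → ℝ≥0} (h : IsClassKInf α) {x y : ℝ≥0} :
    x < FiniteStepISS.inv α y ↔ α x < y := by
  rw [← h.strictMono.lt_iff_lt, h.apply_inv]

/-- The average of a function of class `K∞` and a dominated nondecreasing function. -/
theorem IsClassKInf.average {α β : ℝ≥0 → ℝ≥0} (hα : IsWeakK α) (hβ : IsClassKInf β) :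
    IsClassKInf (fun r => 2⁻¹ * (β r + α r)) :=
  (isClassKInf_mul (by norm_num : (0 : ℝ≥0) < 2⁻¹)).comp (hβ.add_weak hα)

theorem lt_average {a b : ℝ≥0} (h : a < b) : a < 2⁻¹ * (b + a) := by
  rw [← NNReal.coe_lt_coe] at *
  push_cast
  linarith

theorem average_lt {a b : ℝ≥0} (h : a < b) : 2⁻¹ * (b + a) < b := by
  rw [← NNReal.coe_lt_coe] at *
  push_cast
  linarith

/-- A finite family of functions of class `K∞` which dominate `a` has a lower bound of
class `K∞` which dominates `a`. -/
theorem exists_isClassKInf_between {ι : Type*} (S : Finset ι) {a : ℝ≥0 → ℝ≥0} (ha : IsWeakK a)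
    {b : ι → ℝ≥0 → ℝ≥0} (hb : ∀ j ∈ S, IsClassKInf (b j))
    (hab : ∀ j ∈ S, ∀ x, 0 < x → a x < b j x) :
    ∃ c, IsClassKInf c ∧ (∀ x, 0 < x → a x < c x) ∧ ∀ j ∈ S, ∀ x, c x ≤ b j x := by
  classical
  induction S using Finset.induction_on with
  | empty =>
    exact ⟨_, isClassKInf_id.add_weak ha, fun x hx => lt_add_of_pos_left _ hx, by simp⟩
  | insert j S _ ih =>
    obtain ⟨c, hc, hac, hcb⟩ := ih (fun k hk => hb k (Finset.mem_insert_of_mem hk))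
      (fun k hk => hab k (Finset.mem_insert_of_mem hk))
    refine ⟨_, hc.min (hb j (Finset.mem_insert_self _ _)), fun x hx =>
      lt_min (hac x hx) (hab j (Finset.mem_insert_self _ _) x hx), fun k hk x => ?_⟩
    rcases Finset.mem_insert.1 hk with rfl | hk
    · exact min_le_right _ _
    · exact (min_le_left _ _).trans (hcb k hk x)

theorem weak_of_classKInf_or_zero {α : ℝ≥0 → ℝ≥0} (h : IsClassKInf α ∨ α = 0) : IsWeakK α := by
  rcases h with h | rfl
  exacts [h.weak, isWeakK_zero]

theorem classKInf_or_zero_comp {α β : ℝ≥0 → ℝ≥0} (hα : IsClassKInf α ∨ α = 0)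
    (hβ : IsClassKInf β ∨ β = 0) :
    IsClassKInf (fun r => α (β r)) ∨ (fun r => α (β r)) = 0 := by
  rcases hα with hα | rfl
  · rcases hβ with hβ | rfl
    · exact Or.inl (hα.comp hβ)
    · exact Or.inr (by funext r; simp [hα.zero])
  · exact Or.inr rfl

theorem classKInf_or_zero_max {α β : ℝ≥0 → ℝ≥0} (hα : IsClassKInf α ∨ α = 0)
    (hβ : IsClassKInf β ∨ β = 0) :
    IsClassKInf (fun r => max (α r) (β r)) ∨ (fun r => max (α r) (β r)) = 0 := by
  rcases hα with hα | rfl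
  · rcases hβ with hβ | rfl
    · exact Or.inl (hα.max hβ)
    · exact Or.inl (by simpa using hα)
  · rcases hβ with hβ | rfl
    · exact Or.inl (by simpa using hβ)
    · exact Or.inr (by funext r; simp)

/-! ### Potentials by elimination of nodes -/

/-- Gains of class `K∞` or zero satisfying the small-gain condition admit potentials of class
`K∞` which decrease strictly along every gain. -/
theorem exists_potential {N : ℕ} (μ : Fin N → Fin N → ℝ≥0 → ℝ≥0)
    (hμ : ∀ i j, IsClassKInf (μ i j) ∨ μ i j = 0)
    (hsg : ∀ s : Fin N → ℝ≥0, s ≠ 0 → ∃ i, ∀ j, μ i j (s j) < s i) :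
    ∃ g : Fin N → ℝ≥0 → ℝ≥0, (∀ i, IsClassKInf (g i)) ∧
      ∀ i j x, 0 < x → g i (μ i j x) < g j x := by
  induction N with
  | zero => exact ⟨fun i => i.elim0, fun i => i.elim0, fun i => i.elim0⟩
  | succ N ih =>
    -- Node `0` is eliminated: every path through it becomes a direct gain between the remaining
    -- nodes.
    obtain ⟨g, hg, hdec⟩ := ih
      (fun i j x => max (μ i.succ j.succ x) (μ i.succ 0 (μ 0 j.succ x)))
      (fun i j => classKInf_or_zero_max (hμ _ _) (classKInf_or_zero_comp (hμ _ _) (hμ _ _)))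
      (by
        intro s hs
        -- The value given to node `0` is the largest one it receives from the others, so node `0`
        -- cannot be the index of strict decrease.
        obtain ⟨i, hi⟩ := hsg (Fin.cons (Finset.univ.sup fun j => μ 0 j.succ (s j)) s) (by
          rintro h
          apply hs
          funext j
          simpa using congrFun h j.succ)
        have key : ∀ j, μ 0 j.succ (s j) ≤ Finset.univ.sup fun j => μ 0 j.succ (s j) :=
          fun j => Finset.le_sup (f := fun j => μ 0 j.succ (s j)) (Finset.mem_univ j)
        refine Fin.cases (motive := fun i => (∀ j, μ i j ((Fin.cons (Finset.univ.sup fun j =>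
          μ 0 j.succ (s j)) s : Fin (N + 1) → ℝ≥0) j) < (Fin.cons (Finset.univ.sup fun j =>
          μ 0 j.succ (s j)) s : Fin (N + 1) → ℝ≥0) i) → _) ?_ ?_ i hi
        · intro h
          exfalso
          have h0 := h 0
          simp only [Fin.cons_zero] at h0
          refine lt_irrefl _ ((Finset.sup_lt_iff (lt_of_le_of_lt bot_le h0)).2 fun j _ => ?_)
          simpa using h j.succ
        · intro i h
          refine ⟨i, fun j => max_lt (by simpa using h j.succ) ?_⟩
          have h0 := h 0
          simp only [Fin.cons_zero, Fin.cons_succ] at h0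
          exact lt_of_le_of_lt ((weak_of_classKInf_or_zero (hμ _ _)).mono (key j)) h0)
    have ha : IsWeakK (fun x => Finset.univ.sup fun i => g i (μ i.succ 0 x)) :=
      IsWeakK.finsetSup _ fun i => (hg i).weak.comp (weak_of_classKInf_or_zero (hμ _ _))
    classical
    -- The new potential must lie strictly above each `g i ∘ μ i.succ 0` and strictly below each `g
    -- j ∘ (μ 0 j.succ)⁻¹`. The composite gains make this interval nonempty; vanishing gains into
    -- node `0` impose no upper bound.
    obtain ⟨c, hc, hac, hcb⟩ := exists_isClassKInf_between
      (Finset.univ.filter fun j : Fin N => IsClassKInf (μ 0 j.succ)) ha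
      (b := fun j x => g j (inv (μ 0 j.succ) x))
      (fun j hj => (hg j).comp (by simpa using hj : IsClassKInf (μ 0 j.succ)).inv)
      (fun j hj x hx => by
        have hj' : IsClassKInf (μ 0 j.succ) := by simpa using hj
        have hy := hj'.inv.pos hx
        refine (Finset.sup_lt_iff ((hg j).pos hy)).2 fun i _ => lt_of_le_of_lt ?_
          (hdec i j _ hy)
        refine (hg i).strictMono.monotone ?_
        conv_lhs => rw [← hj'.apply_inv x]
        exact le_max_right _ _)
    have hG := IsClassKInf.average ha hc
    refine ⟨Fin.cons (fun r => 2⁻¹ * (c r + Finset.univ.sup fun i => g i (μ i.succ 0 r))) g,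
      fun i => ?_, fun i j x hx => ?_⟩
    · refine Fin.cases ?_ (fun i => ?_) i
      · simpa using hG
      · simpa using hg i
    · refine Fin.cases ?_ (fun i => ?_) i <;> refine Fin.cases ?_ (fun j => ?_) j
      · simp only [Fin.cons_zero]
        refine hG.strictMono ?_
        -- Testing the small-gain condition on a vector supported at node `0` yields `μ 0 0 x < x`.
        obtain ⟨i, hi⟩ := hsg (Pi.single 0 x) (by
          intro h
          have := congrFun h 0
          simp at this
          exact hx.ne' this)
        rcases eq_or_ne i 0 with rfl | h
        · simpa using hi 0
        · have := hi 0
          simp [Pi.single_eq_of_ne h] at this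
      · simp only [Fin.cons_zero, Fin.cons_succ]
        rcases hμ 0 j.succ with h | h
        · refine lt_of_lt_of_le (average_lt (hac _ (h.pos hx))) ?_
          refine (hcb j (by simpa using h) _).trans ?_
          rw [h.inv_apply]
        · rw [h, Pi.zero_apply, hG.zero]
          exact (hg j).pos hx
      · simp only [Fin.cons_zero, Fin.cons_succ]
        exact lt_of_le_of_lt (Finset.le_sup (f := fun i => g i (μ i.succ 0 x))
          (Finset.mem_univ i)) (lt_average (hac x hx))
      · simp only [Fin.cons_succ]
        exact lt_of_le_of_lt ((hg i).strictMono.monotone (le_max_left _ _)) (hdec i j x hx)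

/-! ### Insertion of locally bi-Lipschitz functions -/

/-- Below the diagonal and above a given function of class `K∞` there is a function with slopes in
`[1/2, 3/2]`. -/
theorem exists_bilipschitz_lt_id {p : ℝ≥0 → ℝ≥0} (hp : IsClassKInf p)
    (hlt : ∀ x, 0 < x → p x < x) :
    ∃ κ : ℝ → ℝ, Continuous κ ∧ κ 0 = 0 ∧ (∀ x : ℝ≥0, (p x : ℝ) ≤ κ x) ∧
      (∀ x : ℝ, 0 < x → κ x < x) ∧
      ∀ x y, y ≤ x → 2⁻¹ * (x - y) ≤ κ x - κ y ∧ κ x - κ y ≤ 3 / 2 * (x - y) := by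
  let q : ℝ → ℝ := fun y => y - p y.toNNReal
  have hq : Continuous q := continuous_id.sub
    (NNReal.continuous_coe.comp (hp.cont.comp continuous_real_toNNReal))
  have hq0 : q 0 = 0 := by simp [q, hp.zero]
  -- `S` is the epigraph of `q = id - p`. The distance `e x` from `(x, 0)` to it is 1-Lipschitz,
  -- positive for `x > 0` and at most `q x`; subtracting `e / 2` from the identity gives the slopes
  -- `1/2` and `3/2`.
  let S : Set (ℝ × ℝ) := {z | q z.1 ≤ z.2}
  have hS : IsClosed S := isClosed_le (hq.comp continuous_fst) continuous_snd
  have hS0 : ((0 : ℝ), (0 : ℝ)) ∈ S := hq0.le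
  let e : ℝ → ℝ := fun x => Metric.infDist (x, (0 : ℝ)) S
  have he : ∀ x y, |e x - e y| ≤ |x - y| := fun x y => by
    have := (Metric.lipschitz_infDist_pt S).dist_le_mul (x, (0 : ℝ)) (y, (0 : ℝ))
    simpa [Real.dist_eq, Prod.dist_eq] using this
  have he0 : e 0 = 0 := Metric.infDist_zero_of_mem hS0
  have hec : Continuous e := (Metric.continuous_infDist_pt S).comp (by fun_prop)
  have hepos : ∀ x, 0 < x → 0 < e x := fun x hx => by
    refine (hS.notMem_iff_infDist_pos ⟨_, hS0⟩).1 fun h => ?_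
    have h1 : q x ≤ 0 := h
    have h2 := NNReal.coe_lt_coe.2 (hlt x.toNNReal (Real.toNNReal_pos.2 hx))
    rw [Real.coe_toNNReal _ hx.le] at h2
    simp only [q] at h1
    linarith
  have heq : ∀ x : ℝ≥0, e x ≤ x - p x := fun x => by
    have h1 : (((x : ℝ), q x) : ℝ × ℝ) ∈ S := le_refl (q x)
    have h2 := Metric.infDist_le_dist_of_mem (x := ((x : ℝ), (0 : ℝ))) h1
    have h3 : 0 ≤ q x := by
      rcases eq_or_ne x 0 with rfl | hx
      · simp [hq0]
      · have := NNReal.coe_lt_coe.2 (hlt x (pos_iff_ne_zero.2 hx))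
        simp only [q, Real.toNNReal_coe]
        linarith
    have h4 : q x = x - p x := by simp [q]
    rwa [Prod.dist_eq, dist_self, Real.dist_eq, zero_sub, abs_neg, abs_of_nonneg h3,
      max_eq_right h3, h4] at h2
  refine ⟨fun x => x - e x / 2, by fun_prop, by simp [he0], fun x => ?_, fun x hx => ?_,
    fun x y hxy => ?_⟩
  · have h1 := heq x
    have h2 : 0 ≤ e x := Metric.infDist_nonneg
    linarith
  · have := hepos x hx
    linarith
  · have h1 := abs_le.1 (he x y)
    rw [abs_of_nonneg (sub_nonneg.2 hxy)] at h1
    constructor <;> linarith [h1.1, h1.2]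

/-- Between two functions of class `K∞` there is one which is locally bi-Lipschitz on `(0, ∞)`. -/
theorem exists_bilipschitz_between {f g : ℝ≥0 → ℝ≥0} (hf : IsClassKInf f) (hg : IsClassKInf g)
    (hfg : ∀ x, 0 < x → f x < g x) :
    ∃ h, IsClassKInf h ∧ (∀ x, f x ≤ h x ∧ h x ≤ g x) ∧
      ∀ a b : ℝ≥0, 0 < a → ∃ L : ℝ, ∀ x y : ℝ≥0, a ≤ y → y ≤ x → x ≤ b →
        (x - y : ℝ) ≤ L * (h x - h y) ∧ (h x - h y : ℝ) ≤ L * (x - y) := by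
  obtain ⟨κ, hκc, hκ0, hpκ, hκlt, hκ⟩ := exists_bilipschitz_lt_id (hg.inv.comp hf)
    (fun x hx => by
      rw [← hg.strictMono.lt_iff_lt, hg.apply_inv]
      exact hfg x hx)
  let G : ℝ → ℝ := fun x => g x.toNNReal
  have hGc : Continuous G :=
    NNReal.continuous_coe.comp (hg.cont.comp continuous_real_toNNReal)
  have hGm : Monotone G := fun x y h =>
    NNReal.coe_le_coe.2 (hg.strictMono.monotone (Real.toNNReal_mono h))
  have hG0 : ∀ x, 0 ≤ G x := fun x => NNReal.coe_nonneg _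
  have hGs : ∀ x y, 0 ≤ x → x < y → G x < G y := fun x y hx h =>
    NNReal.coe_lt_coe.2 (hg.strictMono ((Real.toNNReal_lt_toNNReal_iff (hx.trans_lt h)).2 h))
  let P : ℝ → ℝ := fun x => ∫ t in (0 : ℝ)..x, G t
  have hPc : Continuous P := intervalIntegral.continuous_primitive
    (fun a b => hGc.intervalIntegrable a b) 0
  have hPsub : ∀ a b, P b - P a = ∫ t in a..b, G t := fun a b =>
    intervalIntegral.integral_interval_sub_left (hGc.intervalIntegrable _ _)
      (hGc.intervalIntegrable _ _)
  have hPl : ∀ a b, a ≤ b → G a * (b - a) ≤ P b - P a := fun a b hab => by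
    rw [hPsub]
    have := intervalIntegral.integral_mono_on hab (continuous_const (y := G a)
      |>.intervalIntegrable (μ := MeasureTheory.volume) a b)
      (hGc.intervalIntegrable a b) (fun x hx => hGm hx.1)
    simpa [mul_comm] using this
  have hPu : ∀ a b, a ≤ b → P b - P a ≤ G b * (b - a) := fun a b hab => by
    rw [hPsub]
    have := intervalIntegral.integral_mono_on hab (hGc.intervalIntegrable a b)
      (continuous_const (y := G b) |>.intervalIntegrable (μ := MeasureTheory.volume) a b)
      (fun x hx => hGm hx.2)
    simpa [mul_comm] using this
  have hPs : ∀ a b, 0 ≤ a → a < b → P b - P a < G b * (b - a) := fun a b ha hab => by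
    have h1 := hPu a ((a + b) / 2) (by linarith)
    have h2 := hPu ((a + b) / 2) b (by linarith)
    have h3 := mul_lt_mul_of_pos_right (hGs ((a + b) / 2) b (by linarith) (by linarith))
      (by linarith : 0 < (b - a) / 2)
    linarith
  have hκnn : ∀ x, 0 ≤ x → 0 ≤ κ x := fun x hx =>
    (NNReal.coe_nonneg _).trans (hpκ ⟨x, hx⟩)
  -- `A a b` is the mean of `G` over `[a, b]`. The next two estimates describe how it grows when the
  -- right, respectively the left, endpoint moves to the right.
  let A : ℝ → ℝ → ℝ := fun a b => (P b - P a) / (b - a)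
  have hAb : ∀ a b' b, 0 ≤ a → a < b' → b' ≤ b →
      (b - b') * (G b' - A a b') / (b - a) ≤ A a b - A a b' ∧
      A a b - A a b' ≤ (b - b') * G b / (b - a) := fun a b' b ha h1 h2 => by
    have e1 : P b' - P a = A a b' * (b' - a) := (div_mul_cancel₀ _ (by linarith)).symm
    have e2 : A a b - A a b' = (P b - P b' - (b - b') * A a b') / (b - a) := by
      have hne : b - a ≠ 0 := by linarith
      rw [eq_div_iff hne, sub_mul, div_mul_cancel₀ _ hne]
      linear_combination e1
    have hA : 0 ≤ A a b' := div_nonneg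
      ((mul_nonneg (hG0 a) (by linarith)).trans (hPl a b' h1.le)) (by linarith)
    rw [e2]
    refine ⟨(div_le_div_iff_of_pos_right (by linarith)).2 ?_,
      (div_le_div_iff_of_pos_right (by linarith)).2 ?_⟩
    · linarith [hPl b' b h2]
    · linarith [hPu b' b h2, mul_nonneg (by linarith : 0 ≤ b - b') hA]
  have hAa : ∀ a' a b, a' ≤ a → a < b →
      0 ≤ A a b - A a' b ∧ A a b - A a' b ≤ (a - a') * G b / (b - a') := fun a' a b h1 h2 => by
    have e1 : P b - P a = A a b * (b - a) := (div_mul_cancel₀ _ (by linarith)).symm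
    have e2 : A a b - A a' b = ((a - a') * A a b - (P a - P a')) / (b - a') := by
      have hne : b - a' ≠ 0 := by linarith
      rw [eq_div_iff hne, sub_mul, div_mul_cancel₀ _ hne]
      linear_combination -e1
    have hA1 : G a ≤ A a b := (le_div_iff₀ (by linarith)).2 (hPl a b h2.le)
    have hA2 : A a b ≤ G b := (div_le_iff₀ (by linarith)).2 (hPu a b h2.le)
    have h3 : 0 ≤ a - a' := by linarith
    rw [e2]
    refine ⟨div_nonneg ?_ (by linarith), (div_le_div_iff_of_pos_right (by linarith)).2 ?_⟩
    · linarith [hPu a' a h1, mul_le_mul_of_nonneg_left hA1 h3]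
    · linarith [hPl a' a h1, mul_le_mul_of_nonneg_left hA2 h3, mul_nonneg (hG0 a') h3]
  -- The mean of `G` over the window `[κ x, x]` lies between `g (κ x) ≥ g (p x) = f x` and `g x`. At
  -- `0` the quotient `0 / 0 = 0` is the right value.
  let H : ℝ → ℝ := fun x => A (κ x) x
  have hH0 : H 0 = 0 := by simp [H, A, hκ0]
  have hHl : ∀ x : ℝ≥0, (f x : ℝ) ≤ H x := fun x => by
    rcases eq_or_ne x 0 with rfl | hx
    · simp [hf.zero, hH0]
    · have hx : (0 : ℝ) < x := NNReal.coe_pos.2 (pos_iff_ne_zero.2 hx)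
      refine le_trans ?_ ((le_div_iff₀ (by linarith [hκlt x hx])).2 (hPl _ _ (hκlt x hx).le))
      have := hGm (hpκ x)
      simpa [G, hg.apply_inv] using this
  have hHu : ∀ x : ℝ≥0, H x ≤ g x := fun x => by
    rcases eq_or_ne x 0 with rfl | hx
    · simp [hg.zero, hH0]
    · have hx : (0 : ℝ) < x := NNReal.coe_pos.2 (pos_iff_ne_zero.2 hx)
      refine le_trans ((div_le_iff₀ (by linarith [hκlt x hx])).2 (hPu _ _ (hκlt x hx).le)) ?_
      simp [G]
  have hHc : ContinuousOn H (Set.Ioi 0) := fun x hx => by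
    have hne : x - κ x ≠ 0 := by
      have := hκlt x hx
      exact (sub_pos.2 this).ne'
    exact (((hPc.sub (hPc.comp hκc)).continuousAt).div
      (continuous_id.sub hκc).continuousAt hne).continuousWithinAt
  have hHs : ∀ x, 0 < x → H x < G x := fun x hx =>
    (div_lt_iff₀ (by linarith [hκlt x hx])).2 (hPs _ _ (hκnn x hx.le) (hκlt x hx))
  have hbl : ∀ a b : ℝ, 0 < a → ∃ L : ℝ, 0 < L ∧ ∀ x y : ℝ, a ≤ y → y ≤ x → x ≤ b →
      (x - y : ℝ) ≤ L * (H x - H y) ∧ (H x - H y : ℝ) ≤ L * (x - y) := fun a b ha => by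
    rcases lt_or_ge b a with hab | hab
    · exact ⟨1, one_pos, fun x y h1 h2 h3 => absurd (h1.trans (h2.trans h3)) hab.not_ge⟩
    have hsub : Set.Icc a b ⊆ Set.Ioi 0 := fun x hx => ha.trans_le hx.1
    obtain ⟨x₁, hx₁, hm⟩ := isCompact_Icc.exists_isMinOn (Set.nonempty_Icc.2 hab)
      (f := fun x => x - κ x) (by fun_prop)
    obtain ⟨x₂, hx₂, hd⟩ := isCompact_Icc.exists_isMinOn (Set.nonempty_Icc.2 hab)
      (f := fun x => G x - H x) (hGc.continuousOn.sub (hHc.mono hsub))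
    set m := x₁ - κ x₁ with hmdef
    have hmpos : 0 < m := sub_pos.2 (hκlt _ (hsub hx₁))
    set d := G x₂ - H x₂ with hddef
    have hdpos : 0 < d := sub_pos.2 (hHs _ (hsub hx₂))
    have hb : 0 < b := ha.trans_le hab
    -- On `[a, b]` the window has length between `m` and `b`, and `G` exceeds its window mean by at
    -- least `d`. The factor `5/2` is `3/2` from the left endpoint, which moves with `κ`, plus `1`
    -- from the right one.
    refine ⟨max (b / d) (5 / 2 * G b / m), lt_max_of_lt_left (div_pos hb hdpos),
      fun x y h1 h2 h3 => ?_⟩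
    have hy : 0 < y := ha.trans_le h1
    have hyI : y ∈ Set.Icc a b := ⟨h1, h2.trans h3⟩
    have hmy : m ≤ y - κ y := hm hyI
    have hdy : d ≤ G y - H y := hd hyI
    have hk := hκ x y h2
    have hxy : 0 ≤ x - y := by linarith
    obtain ⟨hb1, hb2⟩ := hAb (κ y) y x (hκnn y hy.le) (hκlt y hy) h2
    obtain ⟨ha1, ha2⟩ := hAa (κ y) (κ x) x (by linarith) (hκlt x (hy.trans_le h2))
    have hden : m ≤ x - κ y := by linarith
    have hden2 : x - κ y ≤ b := by linarith [hκnn y hy.le]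
    have hsplit : H x - H y = (A (κ x) x - A (κ y) x) + (A (κ y) x - A (κ y) y) := by
      simp only [H]; ring
    have hGb : G x ≤ G b := hGm h3
    have hlow : (x - y) * d / b ≤ H x - H y := by
      have : (x - y) * d / b ≤ (x - y) * (G y - A (κ y) y) / (x - κ y) :=
        div_le_div₀ (mul_nonneg hxy (hdpos.le.trans hdy)) (mul_le_mul_of_nonneg_left hdy hxy)
          (hmpos.trans_le hden) hden2
      linarith
    have hup : H x - H y ≤ 5 / 2 * G b / m * (x - y) := by
      have e1 : (κ x - κ y) * G x / (x - κ y) ≤ 3 / 2 * (x - y) * G b / m :=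
        div_le_div₀ (mul_nonneg (by linarith) (hG0 b))
          (mul_le_mul hk.2 hGb (hG0 x) (by linarith)) hmpos hden
      have e2 : (x - y) * G x / (x - κ y) ≤ (x - y) * G b / m :=
        div_le_div₀ (mul_nonneg hxy (hG0 b)) (mul_le_mul_of_nonneg_left hGb hxy) hmpos hden
      have e3 : 5 / 2 * G b / m * (x - y) =
        3 / 2 * (x - y) * G b / m + (x - y) * G b / m := by ring
      linarith
    have hHnn : 0 ≤ H x - H y :=
      (div_nonneg (mul_nonneg hxy hdpos.le) hb.le).trans hlow
    constructor
    · refine le_trans ?_ (mul_le_mul_of_nonneg_right (le_max_left _ _) hHnn)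
      rw [div_mul_eq_mul_div, le_div_iff₀ hdpos]
      rw [div_le_iff₀ hb] at hlow
      linarith
    · exact hup.trans (mul_le_mul_of_nonneg_right (le_max_right _ _) hxy)
  have hcoe : ∀ x : ℝ≥0, ((H x).toNNReal : ℝ) = H x := fun x =>
    Real.coe_toNNReal _ ((NNReal.coe_nonneg _).trans (hHl x))
  have hfh : ∀ x : ℝ≥0, f x ≤ (H x).toNNReal := fun x => by
    rw [← NNReal.coe_le_coe, hcoe]; exact hHl x
  have hhg : ∀ x : ℝ≥0, (H x).toNNReal ≤ g x := fun x => by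
    rw [← NNReal.coe_le_coe, hcoe]; exact hHu x
  refine ⟨fun x => (H x).toNNReal, ⟨⟨by simp [hH0], ?_, fun y x hyx => ?_⟩,
    tendsto_atTop_mono hfh hf.tendsto⟩, fun x => ⟨hfh x, hhg x⟩, fun a b ha => ?_⟩
  · refine continuous_iff_continuousAt.2 fun x => ?_
    rcases eq_or_ne x 0 with rfl | hx
    · have h1 : Tendsto g (𝓝 0) (𝓝 0) := by simpa [hg.zero] using hg.cont.tendsto 0
      have : Tendsto (fun x : ℝ≥0 => (H x).toNNReal) (𝓝 0) (𝓝 0) :=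
        tendsto_of_tendsto_of_tendsto_of_le_of_le tendsto_const_nhds h1 (fun _ => zero_le) hhg
      simpa [ContinuousAt, hH0] using this
    · have hx : (0 : ℝ) < x := NNReal.coe_pos.2 (pos_iff_ne_zero.2 hx)
      exact continuous_real_toNNReal.continuousAt.comp
        (ContinuousAt.comp (f := ((↑) : ℝ≥0 → ℝ)) (hHc.continuousAt (Ioi_mem_nhds hx))
          NNReal.continuous_coe.continuousAt)
  · rw [← NNReal.coe_lt_coe, hcoe, hcoe]
    rcases eq_or_ne y 0 with rfl | hy
    · rw [NNReal.coe_zero, hH0]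
      exact (NNReal.coe_pos.2 (hf.pos hyx)).trans_le (hHl x)
    · have hy : (0 : ℝ) < y := NNReal.coe_pos.2 (pos_iff_ne_zero.2 hy)
      obtain ⟨L, hL, h⟩ := hbl y x hy
      have h1 := (h x y le_rfl (NNReal.coe_le_coe.2 hyx.le) le_rfl).1
      have h2 : (0 : ℝ) < x - y := sub_pos.2 (NNReal.coe_lt_coe.2 hyx)
      exact sub_pos.1 (pos_of_mul_pos_right (h2.trans_le h1) hL.le)
  · obtain ⟨L, -, h⟩ := hbl a b (NNReal.coe_pos.2 ha)
    refine ⟨L, fun x y h1 h2 h3 => ?_⟩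
    rw [hcoe, hcoe]
    exact h x y (NNReal.coe_le_coe.2 h1) (NNReal.coe_le_coe.2 h2) (NNReal.coe_le_coe.2 h3)

/-! ### Construction of the path -/

theorem realInv_inv {h : ℝ≥0 → ℝ≥0} (hh : IsClassKInf h) (r : ℝ) :
    realInv (inv h) r = h r.toNNReal := by
  rw [realInv, hh.inv_inv]

/-- Potentials which are locally bi-Lipschitz on `(0, ∞)` and decrease strictly along all gains
are the inverses of the components of an `Ω`-path. -/
theorem isOmegaPath_inv {N : ℕ} {T : (Fin N → ℝ≥0) → Fin N → ℝ≥0} {h : Fin N → ℝ≥0 → ℝ≥0}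
    (hh : ∀ i, IsClassKInf (h i))
    (hL : ∀ i, ∀ a b : ℝ≥0, 0 < a → ∃ L : ℝ, ∀ x y : ℝ≥0, a ≤ y → y ≤ x → x ≤ b →
        (x - y : ℝ) ≤ L * (h i x - h i y) ∧ (h i x - h i y : ℝ) ≤ L * (x - y))
    (hT : ∀ r, 0 < r → ∀ i, T (fun j => inv (h j) r) i < inv (h i) r) :
    IsOmegaPath T fun i => inv (h i) := by
  have key : ∀ a b : ℝ, 0 < a → ∃ L : ℝ, 1 < L ∧ ∀ i, ∀ x y : ℝ, a ≤ y → y ≤ x → x ≤ b →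
      x - y ≤ L * (realInv (inv (h i)) x - realInv (inv (h i)) y) ∧
      realInv (inv (h i)) x - realInv (inv (h i)) y ≤ L * (x - y) := fun a b ha => by
    choose L hL using fun i => hL i a.toNNReal b.toNNReal (Real.toNNReal_pos.2 ha)
    obtain ⟨C, hC⟩ := Finite.exists_le L
    -- The lower bound `2` ensures `L > 1`, hence `L⁻¹ < L` for the derivative bounds.
    refine ⟨max C 2, lt_max_of_lt_right one_lt_two, fun i x y h1 h2 h3 => ?_⟩
    have hy : 0 < y := ha.trans_le h1
    obtain ⟨e1, e2⟩ := hL i x.toNNReal y.toNNReal (Real.toNNReal_mono h1)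
      (Real.toNNReal_mono h2) (Real.toNNReal_mono h3)
    rw [Real.coe_toNNReal _ hy.le, Real.coe_toNNReal _ (hy.le.trans h2)] at e1 e2
    have hmono : (0 : ℝ) ≤ h i x.toNNReal - h i y.toNNReal :=
      sub_nonneg.2 (NNReal.coe_le_coe.2 ((hh i).strictMono.monotone (Real.toNNReal_mono h2)))
    have hLC : L i ≤ max C 2 := (hC i).trans (le_max_left _ _)
    rw [realInv_inv (hh i), realInv_inv (hh i)]
    exact ⟨e1.trans (mul_le_mul_of_nonneg_right hLC hmono),
      e2.trans (mul_le_mul_of_nonneg_right hLC (sub_nonneg.2 h2))⟩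
  have hmono : ∀ i, Monotone (realInv (inv (h i))) := fun i x y hxy => by
    rw [realInv_inv (hh i), realInv_inv (hh i)]
    exact NNReal.coe_le_coe.2 ((hh i).strictMono.monotone (Real.toNNReal_mono hxy))
  refine ⟨fun i => (hh i).inv, fun i x hx => ?_, fun K hK hK0 => ?_, hT⟩
  · have hx : 0 < x := hx
    obtain ⟨L, hL1, hL⟩ := key (x / 2) (x + 1) (by linarith)
    refine ⟨L.toNNReal, Set.Icc (x / 2) (x + 1), mem_nhdsWithin_of_mem_nhds
      (Icc_mem_nhds (by linarith) (by linarith)), LipschitzOnWith.of_dist_le_mul ?_⟩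
    have hstep : ∀ y ∈ Set.Icc (x / 2) (x + 1), ∀ z ∈ Set.Icc (x / 2) (x + 1), y ≤ z →
        dist (realInv (inv (h i)) y) (realInv (inv (h i)) z) ≤ L.toNNReal * dist y z := by
      intro y hy z hz hyz
      rw [dist_comm, dist_comm y, Real.dist_eq, Real.dist_eq, abs_of_nonneg (sub_nonneg.2 hyz),
        abs_of_nonneg (sub_nonneg.2 (hmono i hyz)), Real.coe_toNNReal _ (by linarith)]
      exact (hL i z y hy.1 hyz hz.2).2
    intro y hy z hz
    rcases le_total y z with hyz | hyz
    · exact hstep y hy z hz hyz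
    · rw [dist_comm, dist_comm y]
      exact hstep z hz y hy hyz
  · rcases K.eq_empty_or_nonempty with rfl | hne
    · exact ⟨1, 2, one_pos, one_lt_two, by simp⟩
    obtain ⟨a, haK, ha⟩ := hK.exists_isLeast hne
    obtain ⟨b, hbK, hb⟩ := hK.exists_isGreatest hne
    -- The extra unit leaves room for slopes to the right of `r`, even when `r = b`.
    obtain ⟨L, hL1, hL⟩ := key a (b + 1) (hK0 haK)
    have hL0 : 0 < L := one_pos.trans hL1
    refine ⟨L⁻¹, L, inv_pos.2 hL0, (inv_lt_one_of_one_lt₀ hL1).trans hL1, fun i r hr hd => ?_⟩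
    have hlim := (hasDerivWithinAt_iff_tendsto_slope' (s := Set.Ioi r) (by simp)).1
      hd.hasDerivAt.hasDerivWithinAt
    have hev : ∀ᶠ y in 𝓝[>] r, y ∈ Set.Ioo r (r + 1) :=
      Ioo_mem_nhdsGT (by linarith)
    refine ⟨ge_of_tendsto hlim ?_, le_of_tendsto hlim ?_⟩ <;> filter_upwards [hev] with y hy <;>
      rw [slope_def_field] <;>
      have hs := hL i y r (ha hr) hy.1.le (by linarith [hb hr, hy.2]) <;>
      have hpos : 0 < y - r := sub_pos.2 hy.1
    · rw [le_div_iff₀ hpos, inv_mul_le_iff₀ hL0]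
      exact hs.1
    · rw [div_le_iff₀ hpos]
      exact hs.2

/-- Gains of class `K∞` or zero satisfying the small-gain condition admit an `Ω`-path. -/
theorem exists_isOmegaPath {N : ℕ} {T : (Fin N → ℝ≥0) → Fin N → ℝ≥0}
    (μ : Fin N → Fin N → ℝ≥0 → ℝ≥0) (hμ : ∀ i j, IsClassKInf (μ i j) ∨ μ i j = 0)
    (hTμ : ∀ s i, T s i = Finset.univ.sup fun j => μ i j (s j)) (hsg : NotGeId T) :
    ∃ σ, IsOmegaPath T σ := by
  obtain ⟨g, hg, hdec⟩ := exists_potential μ hμ fun s hs => by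
    obtain ⟨i, hi⟩ := hsg s hs
    rw [hTμ] at hi
    exact ⟨i, fun j => lt_of_le_of_lt
      (Finset.le_sup (f := fun j => μ i j (s j)) (Finset.mem_univ j)) hi⟩
  let a : Fin N → ℝ≥0 → ℝ≥0 := fun j x => Finset.univ.sup fun i => g i (μ i j x)
  have ha : ∀ j, IsWeakK (a j) := fun j =>
    IsWeakK.finsetSup _ fun i => (hg i).weak.comp (weak_of_classKInf_or_zero (hμ _ _))
  have hag : ∀ j x, 0 < x → a j x < g j x := fun j x hx =>
    (Finset.sup_lt_iff ((hg j).pos hx)).2 fun i _ => hdec i j x hx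
  -- The lower barrier is the average of `a j` and `g j`: it stays strictly above `a j`, and it is
  -- of class `K∞` even though `a j` may vanish.
  choose h hh hfg hL using fun j => exists_bilipschitz_between (IsClassKInf.average (ha j) (hg j))
    (hg j) (fun x hx => average_lt (hag j x hx))
  refine ⟨_, isOmegaPath_inv hh hL fun r hr i => ?_⟩
  rw [hTμ]
  refine (Finset.sup_lt_iff ((hh i).inv.pos hr)).2 fun j _ => ?_
  rw [(hh i).lt_inv_iff]
  have hx : 0 < inv (h j) r := (hh j).inv.pos hr
  calc h i (μ i j (inv (h j) r)) ≤ g i (μ i j (inv (h j) r)) := (hfg i _).2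
    _ ≤ a j (inv (h j) r) :=
      Finset.le_sup (f := fun i => g i (μ i j (inv (h j) r))) (Finset.mem_univ i)
    _ < 2⁻¹ * (g j (inv (h j) r) + a j (inv (h j) r)) := lt_average (hag j _ hx)
    _ ≤ h j (inv (h j) r) := (hfg j _).1
    _ = r := (hh j).apply_inv r

/-- The strong small-gain condition passes to the conjugated gain map. -/
theorem NotGeId.conjugate {N : ℕ} {D D₁ D₂ Γ : (Fin N → ℝ≥0) → Fin N → ℝ≥0}
    {δ₂ : Fin N → ℝ≥0 → ℝ≥0} (hδ₂ : ∀ i, IsClassKInf (δ₂ i)) (hD₂ : D₂ = diagOp δ₂)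
    (hD : D = D₂ ∘ D₁) (h : NotGeId (D ∘ Γ)) : NotGeId (D₁ ∘ Γ ∘ D₂) := by
  subst hD₂ hD
  intro s hs
  obtain ⟨i, hi⟩ := h (diagOp δ₂ s) fun h0 => hs <| by
    funext i
    exact (hδ₂ i).idAdd.strictMono.injective ((congrFun h0 i).trans (hδ₂ i).idAdd.zero.symm)
  exact ⟨i, (hδ₂ i).idAdd.strictMono.lt_iff_lt.1 hi⟩

/-- Monotone maps fixing `0` commute with finite maxima, so conjugation keeps the maximum form and
only changes the gains. -/
theorem diagOp_gainMap_diagOp {N : ℕ} {δ₁ δ₂ : Fin N → ℝ≥0 → ℝ≥0} (γ : Fin N → Fin N → ℝ≥0 → ℝ≥0)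
    (hδ₁ : ∀ i, IsClassKInf (δ₁ i)) (s : Fin N → ℝ≥0) (i : Fin N) :
    (diagOp δ₁ ∘ gainMap γ ∘ diagOp δ₂) s i =
      Finset.univ.sup fun j => idAdd (δ₁ i) (γ i j (idAdd (δ₂ j) (s j))) := by
  change idAdd (δ₁ i) (Finset.univ.sup fun j => γ i j (idAdd (δ₂ j) (s j))) = _
  exact Finset.apply_sup_eq_sup_comp_of_linearOrder _ (hδ₁ i).idAdd.strictMono.monotone
    (hδ₁ i).idAdd.zero

theorem exists_isOmegaPath_of_strong_smallGain {N : ℕ} {δ δ₁ δ₂ : Fin N → ℝ≥0 → ℝ≥0}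
    (hδ₁ : ∀ i, IsClassKInf (δ₁ i)) (hδ₂ : ∀ i, IsClassKInf (δ₂ i))
    (hD : diagOp δ = diagOp δ₂ ∘ diagOp δ₁)
    {γ : Fin N → Fin N → ℝ≥0 → ℝ≥0} (hγ : ∀ i j, IsClassKInf (γ i j) ∨ γ i j = 0)
    (hsg : NotGeId (diagOp δ ∘ gainMap γ)) :
    ∃ σ, IsOmegaPath (diagOp δ₁ ∘ gainMap γ ∘ diagOp δ₂) σ :=
  exists_isOmegaPath (fun i j x => idAdd (δ₁ i) (γ i j (idAdd (δ₂ j) x)))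
    (fun i j => by
      rcases hγ i j with h | h
      · exact Or.inl ((hδ₁ i).idAdd.comp (h.comp (hδ₂ j).idAdd))
      · exact Or.inr (by funext x; simp [h, (hδ₁ i).idAdd.zero]))
    (diagOp_gainMap_diagOp γ hδ₁) (hsg.conjugate hδ₂ rfl hD)

/-! ### Iterates and `KL` bounds -/

theorem IsWeakK.iterate {ρ : ℝ≥0 → ℝ≥0} (h : IsWeakK ρ) (k : ℕ) : IsWeakK ρ^[k] where
  zero := Function.iterate_fixed h.zero k
  cont := h.cont.iterate k
  mono := h.mono.iterate k

theorem IsWeakK.map_max {α : ℝ≥0 → ℝ≥0} (h : IsWeakK α) (a b : ℝ≥0) :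
    α (max a b) = max (α a) (α b) := h.mono.map_max

theorem IsWeakK.map_add_le {α : ℝ≥0 → ℝ≥0} (h : IsWeakK α) (a b : ℝ≥0) :
    α (a + b) ≤ α (2 * a) + α (2 * b) := by
  rcases le_total a b with hab | hab
  · refine (h.mono ?_).trans le_add_self
    rw [two_mul]; gcongr
  · refine (h.mono ?_).trans le_self_add
    rw [two_mul]; gcongr

theorem IsWeakK.lt_id_le {ρ : ℝ≥0 → ℝ≥0} (h : IsWeakK ρ) (hlt : ∀ r, 0 < r → ρ r < r) (r : ℝ≥0) :
    ρ r ≤ r := by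
  rcases eq_or_ne r 0 with rfl | hr
  exacts [h.zero.le, (hlt r (pos_iff_ne_zero.2 hr)).le]

theorem IsWeakK.antitone_iterate {ρ : ℝ≥0 → ℝ≥0} (h : IsWeakK ρ) (hlt : ∀ r, 0 < r → ρ r < r)
    (r : ℝ≥0) : Antitone fun k => ρ^[k] r :=
  antitone_nat_of_succ_le fun k => by
    rw [Function.iterate_succ_apply']
    exact h.lt_id_le hlt _

/-- The decreasing orbit converges to a fixed point of `ρ`, and `ρ r < r` leaves only `0`. -/
theorem IsWeakK.tendsto_iterate {ρ : ℝ≥0 → ℝ≥0} (h : IsWeakK ρ) (hlt : ∀ r, 0 < r → ρ r < r)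
    (r : ℝ≥0) : Tendsto (fun k => ρ^[k] r) atTop (𝓝 0) := by
  have hlim := tendsto_atTop_ciInf (h.antitone_iterate hlt r) (OrderBot.bddBelow _)
  have hfix := isFixedPt_of_tendsto_iterate hlim h.cont.continuousAt
  rcases eq_or_ne (⨅ k, ρ^[k] r) 0 with h0 | h0
  · rwa [h0] at hlim
  · exact absurd hfix (hlt _ (pos_iff_ne_zero.2 h0)).ne

/-- A sequence of functions decreasing to zero is dominated by a continuous nonincreasing function
of time. -/
theorem exists_continuous_envelope {b : ℕ → ℝ≥0 → ℝ≥0} (hb : ∀ k, IsWeakK (b k))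
    (hanti : ∀ s, Antitone fun k => b k s) (hlim : ∀ s, Tendsto (fun k => b k s) atTop (𝓝 0)) :
    ∃ E : ℝ≥0 → ℝ≥0 → ℝ≥0, (∀ t, IsWeakK fun s => E s t) ∧ (∀ s, Continuous (E s)) ∧
      (∀ s, Antitone (E s)) ∧ (∀ s, Tendsto (E s) atTop (𝓝 0)) ∧
      ∀ (k : ℕ) (s t : ℝ≥0), t < k + 1 → b k s ≤ E s t := by
  -- A cutoff equal to `1` up to time `k + 1` and to `0` from `k + 2` on; truncated subtraction
  -- keeps it nonnegative.
  let φ : ℕ → ℝ≥0 → ℝ≥0 := fun k t => min 1 ((k + 2 : ℝ≥0) - t)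
  have hφc : ∀ k, Continuous (φ k) := fun k => by
    exact continuous_const.min (continuous_const.sub continuous_id)
  have hφm : ∀ k, Antitone (φ k) := fun k x y h => min_le_min_left _ (tsub_le_tsub_left h _)
  have hφ1 : ∀ k t, φ k t ≤ 1 := fun k t => min_le_left _ _
  have hφe : ∀ (k : ℕ) (t : ℝ≥0), t ≤ k + 1 → φ k t = 1 := fun k t h => by
    refine min_eq_left (le_tsub_of_add_le_left ?_)
    calc t + 1 ≤ (k + 1) + 1 := by gcongr
      _ = k + 2 := by ring
  have hφ0 : ∀ (k : ℕ) (t : ℝ≥0), (k + 2 : ℝ≥0) ≤ t → φ k t = 0 := fun k t h => by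
    simp only [φ, tsub_eq_zero_of_le h, min_eq_right zero_le]
  let F : ℕ → ℝ≥0 → ℝ≥0 → ℝ≥0 := fun n s t => (Finset.range (n + 1)).sup fun k => b k s * φ k t
  have hFle : ∀ {n s t} {k : ℕ}, k ≤ n → b k s * φ k t ≤ F n s t := fun {n s t k} h =>
    Finset.le_sup (f := fun k => b k s * φ k t) (Finset.mem_range.2 (by omega))
  -- Up to time `n + 1` the terms beyond `n` are dominated by the `n`th, whose cutoff is still `1`.
  -- Hence the supremum over all `k` is locally a finite one.
  have hFeq : ∀ (n m : ℕ) (s t : ℝ≥0), t ≤ n + 1 → n ≤ m → F m s t = F n s t := fun n m s t ht hnm => by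
    refine le_antisymm (Finset.sup_le fun k _ => ?_)
      (Finset.sup_mono (Finset.range_mono (by omega)))
    rcases le_total k n with hk | hk
    · exact hFle hk
    · refine le_trans ?_ (hFle le_rfl)
      rw [hφe n t ht]
      exact mul_le_mul' (hanti s hk) (hφ1 k t)
  have hfl : ∀ t : ℝ≥0, t ≤ (⌊t⌋₊ : ℝ≥0) + 1 := fun t => (Nat.lt_floor_add_one t).le
  let E : ℝ≥0 → ℝ≥0 → ℝ≥0 := fun s t => F ⌊t⌋₊ s t
  have hEF : ∀ (n : ℕ) (s t : ℝ≥0), t < n + 1 → E s t = F n s t := fun n s t ht => by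
    refine (hFeq _ _ s t (hfl t) ?_).symm
    exact Nat.lt_succ_iff.1 ((Nat.floor_lt zero_le).2 (by exact_mod_cast ht))
  have hEanti : ∀ s, Antitone (E s) := fun s t t' h => by
    have ht' := Nat.lt_floor_add_one t'
    rw [hEF _ s t (h.trans_lt ht'), hEF _ s t' ht']
    exact Finset.sup_mono_fun fun k _ => mul_le_mul_right (hφm k h) _
  have hEc : ∀ s, Continuous (E s) := fun s => by
    refine continuous_iff_continuousAt.2 fun t => ?_
    have hFc : Continuous (F (⌊t⌋₊) s) :=
      Continuous.finset_sup_apply fun k _ => continuous_const.mul (hφc k)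
    refine hFc.continuousAt.congr ?_
    filter_upwards [Iio_mem_nhds (Nat.lt_floor_add_one t)] with t' ht'
    exact (hEF _ s t' ht').symm
  have hEw : ∀ t, IsWeakK fun s => E s t := fun t =>
    IsWeakK.finsetSup _ fun k => ⟨by simp [(hb k).zero], (hb k).cont.mul continuous_const,
      fun x y h => mul_le_mul_left ((hb k).mono h) _⟩
  have hElim : ∀ s, Tendsto (E s) atTop (𝓝 0) := fun s => by
    rw [tendsto_order]
    refine ⟨fun a ha => absurd ha not_lt_zero, fun a ha => ?_⟩
    obtain ⟨k, hk⟩ := ((hlim s).eventually_lt_const ha).exists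
    filter_upwards [eventually_ge_atTop (k + 2 : ℝ≥0)] with t ht
    refine lt_of_le_of_lt (Finset.sup_le fun l _ => ?_) hk
    rcases le_total k l with hl | hl
    · exact (mul_le_of_le_one_right zero_le (hφ1 l t)).trans (hanti s hl)
    · rw [hφ0 l t (le_trans (by gcongr) ht), mul_zero]
      exact zero_le
  refine ⟨E, hEw, hEc, hEanti, hElim, fun k s t h1 => ?_⟩
  rw [hEF k s t h1]
  refine le_trans ?_ (hFle le_rfl)
  rw [hφe k t h1.le, mul_one]

/-- A sequence of functions decreasing to zero is dominated by a function of class `KL`. -/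
theorem exists_isClassKL {b : ℕ → ℝ≥0 → ℝ≥0} (hb : ∀ k, IsWeakK (b k))
    (hanti : ∀ s, Antitone fun k => b k s) (hlim : ∀ s, Tendsto (fun k => b k s) atTop (𝓝 0))
    {M : ℕ} (hM : 1 ≤ M) :
    ∃ β, IsClassKL β ∧ ∀ k j s, j < M → b k s ≤ β s ((k * M + j : ℕ) : ℝ≥0) := by
  have hM0 : (0 : ℝ≥0) < M := by exact_mod_cast hM
  obtain ⟨E, hEw, hEc, hEanti, hElim, hbE⟩ := exists_continuous_envelope hb hanti hlim
  have hcont : Continuous fun t : ℝ≥0 => (1 + t)⁻¹ :=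
    (continuous_const.add continuous_id).inv₀ fun t => (by positivity : (0 : ℝ≥0) < 1 + t).ne'
  have hinv0 : Tendsto (fun t : ℝ≥0 => (1 + t)⁻¹) atTop (𝓝 0) := by
    refine tendsto_order.2 ⟨fun a ha => absurd ha not_lt_zero, fun a ha => ?_⟩
    filter_upwards [eventually_ge_atTop a⁻¹] with t ht
    exact inv_lt_of_inv_lt₀ ha (lt_of_le_of_lt ht (lt_add_of_pos_left _ one_pos))
  -- The summand `s / (1 + t)` supplies strict monotonicity in both variables; `E` does the
  -- dominating.
  refine ⟨fun s t => (1 + t)⁻¹ * s + E s (t / M), ⟨fun t => ?_, fun s hs => ⟨?_, ?_, ?_⟩⟩, ?_⟩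
  · exact (isClassKInf_mul (by positivity)).toIsClassK.add_weak (hEw _)
  · exact (hcont.mul continuous_const).add ((hEc s).comp (continuous_id.div_const _))
  · intro t t' h
    refine add_lt_add_of_lt_of_le (mul_lt_mul_of_pos_right ?_ hs) (hEanti s (by gcongr))
    exact inv_strictAnti₀ (by positivity) (by gcongr)
  · have h1 := hinv0.mul_const s
    have h2 := (hElim s).comp (tendsto_id.atTop_div_const hM0)
    have h3 := h1.add h2
    rw [zero_mul, add_zero] at h3
    exact h3
  · intro k j s hj
    have h1 : ((k * M + j : ℕ) : ℝ≥0) / M < k + 1 := by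
      rw [div_lt_iff₀ hM0]
      have : k * M + j < (k + 1) * M := by rw [add_mul]; omega
      exact_mod_cast this
    exact (hbE k s _ h1).trans le_add_self

/-! ### From finite-step decrease to ISS -/

section System

variable {X U : Type*} [AddCommGroup X] [Module ℝ X] [AddCommGroup U] [Module ℝ U]

theorem solution_add {X U : Type*} (G : X → U → X) (ξ : X) (u : ℕ → U) (k l : ℕ) :
    solution G ξ u (k + l) = solution G (solution G ξ u k) (fun i => u (k + i)) l := by
  induction l with
  | zero => rfl
  | succ l ih => rw [← add_assoc, solution, solution, ih]

theorem IsBoundedInput.shift {pU : Seminorm ℝ U} {u : ℕ → U} (hu : IsBoundedInput pU u) (k : ℕ) :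
    IsBoundedInput pU fun i => u (k + i) :=
  BddAbove.mono (Set.range_subset_iff.2 fun i => Set.mem_range_self (k + i)) hu

theorem IsBoundedInput.nrm_le {pU : Seminorm ℝ U} {u : ℕ → U} (hu : IsBoundedInput pU u) (k : ℕ) :
    nrm pU (u k) ≤ supNrm pU u := le_ciSup hu k

theorem IsBoundedInput.supNrm_shift_le {pU : Seminorm ℝ U} {u : ℕ → U} (hu : IsBoundedInput pU u)
    (k : ℕ) : supNrm pU (fun i => u (k + i)) ≤ supNrm pU u :=
  ciSup_le fun i => hu.nrm_le (k + i)

/-- Iterated `K`-boundedness, needed because a finite-step decrease says nothing about the times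
between multiples of `M`. -/
theorem GloballyKBounded.exists_solution_le {pX : Seminorm ℝ X} {pU : Seminorm ℝ U}
    {G : X → U → X} (hG : GloballyKBounded pX pU G) (j : ℕ) :
    ∃ κ ν : ℝ≥0 → ℝ≥0, IsWeakK κ ∧ IsWeakK ν ∧ ∀ ξ u, IsBoundedInput pU u →
      nrm pX (solution G ξ u j) ≤ κ (nrm pX ξ) + ν (supNrm pU u) := by
  obtain ⟨ω₁, ω₂, h₁, h₂, hω⟩ := hG
  induction j with
  | zero => exact ⟨_, _, isClassKInf_id.weak, isWeakK_zero, fun ξ u _ => le_self_add⟩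
  | succ j ih =>
    obtain ⟨κ, ν, hκ, hν, h⟩ := ih
    have h2 : IsWeakK fun r : ℝ≥0 => 2 * r := (isClassKInf_mul two_pos).weak
    refine ⟨_, _, h₁.weak.comp (h2.comp hκ), (h₁.weak.comp (h2.comp hν)).add h₂.weak,
      fun ξ u hu => ?_⟩
    rw [← add_assoc]
    refine (hω _ _).trans (add_le_add ?_ (h₂.weak.mono (hu.nrm_le j)))
    exact (h₁.weak.mono (h ξ u hu)).trans (h₁.weak.map_add_le _ _)

/-- A proper and positive definite function which decreases in `M` steps up to the input, in
maximum form, certifies input-to-state stability. -/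
theorem isISS_of_finiteStep_max {pX : Seminorm ℝ X} {pU : Seminorm ℝ U} {G : X → U → X}
    (hG : GloballyKBounded pX pU G) {W : X → ℝ≥0} (hW : IsProperPosDef (nrm pX) W)
    {M : ℕ} (hM : 1 ≤ M) {ρ σ : ℝ≥0 → ℝ≥0} (hρ : IsWeakK ρ) (hlt : ∀ r, 0 < r → ρ r < r)
    (hσ : IsWeakK σ)
    (hdec : ∀ ξ u, IsBoundedInput pU u →
      W (solution G ξ u M) ≤ max (ρ (W ξ)) (σ (supNrm pU u))) :
    IsISS pX pU G := by
  obtain ⟨α₁, α₂, hα₁, hα₂, hα⟩ := hW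
  choose κ ν hκ hν hb using fun j => hG.exists_solution_le j
  -- Thanks to the maximum form and `ρ ≤ id`, the input term does not grow with the number of
  -- iterations.
  have hiter : ∀ (k : ℕ) ξ u, IsBoundedInput pU u →
      W (solution G ξ u (k * M)) ≤ max (ρ^[k] (W ξ)) (σ (supNrm pU u)) := fun k ξ u hu => by
    induction k with
    | zero => simp [solution]
    | succ k ih =>
      rw [add_mul, one_mul, solution_add, Function.iterate_succ_apply']
      refine (hdec _ _ (hu.shift _)).trans (max_le ?_ ?_)
      · refine (hρ.mono ih).trans ?_
        rw [hρ.map_max]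
        exact max_le_max le_rfl (hρ.lt_id_le hlt _)
      · exact le_max_of_le_right (hσ.mono (hu.supNrm_shift_le _))
  have hK : IsWeakK fun r => (Finset.range M).sup fun j => κ j r := IsWeakK.finsetSup _ hκ
  have hL : IsWeakK fun r => (Finset.range M).sup fun j => ν j r := IsWeakK.finsetSup _ hν
  have hKα := hK.comp hα₁.inv.weak
  obtain ⟨β, hβ, hle⟩ := exists_isClassKL
    (fun k => hKα.comp ((hρ.iterate k).comp hα₂.weak))
    (fun s k l hkl => hKα.mono (hρ.antitone_iterate hlt (α₂ s) hkl))
    (fun s => by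
      have := (hKα.cont.tendsto 0).comp (hρ.tendsto_iterate hlt (α₂ s))
      rwa [hKα.zero] at this) hM
  refine ⟨β, _, hβ, isClassKInf_id.toIsClassK.add_weak ((hKα.comp hσ).add hL), fun ξ u hu t => ?_⟩
  obtain ⟨k, j, hj, rfl⟩ : ∃ k j, j < M ∧ t = k * M + j :=
    ⟨t / M, t % M, Nat.mod_lt _ hM, by rw [mul_comm, Nat.div_add_mod]⟩
  have hx : nrm pX (solution G ξ u (k * M)) ≤
      inv α₁ (max (ρ^[k] (α₂ (nrm pX ξ))) (σ (supNrm pU u))) := by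
    rw [← hα₁.strictMono.le_iff_le, hα₁.apply_inv]
    refine (hα _).1.trans ((hiter k ξ u hu).trans (max_le_max ?_ le_rfl))
    exact (hρ.iterate k).mono (hα ξ).2
  have hj' : j ∈ Finset.range M := Finset.mem_range.2 hj
  calc nrm pX (solution G ξ u (k * M + j))
      ≤ κ j (nrm pX (solution G ξ u (k * M))) + ν j (supNrm pU u) := by
        rw [solution_add]
        exact (hb j _ _ (hu.shift _)).trans
          (add_le_add le_rfl ((hν j).mono (hu.supNrm_shift_le _)))
    _ ≤ ((Finset.range M).sup fun j => κ j (inv α₁ (ρ^[k] (α₂ (nrm pX ξ))))) +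
          ((Finset.range M).sup fun j => κ j (inv α₁ (σ (supNrm pU u)))) +
          ((Finset.range M).sup fun j => ν j (supNrm pU u)) := by
        refine add_le_add ?_ (Finset.le_sup (f := fun j => ν j (supNrm pU u)) hj')
        refine (Finset.le_sup (f := fun j => κ j (nrm pX (solution G ξ u (k * M)))) hj').trans ?_
        refine (hK.mono hx).trans ?_
        rw [hKα.map_max]
        exact max_le_add_of_nonneg zero_le zero_le
    _ ≤ β (nrm pX ξ) ((k * M + j : ℕ) : ℝ≥0) +
          (supNrm pU u + (((Finset.range M).sup fun j => κ j (inv α₁ (σ (supNrm pU u)))) +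
          ((Finset.range M).sup fun j => ν j (supNrm pU u)))) := by
        rw [add_assoc]
        exact add_le_add (hle k j _ hj) le_add_self

end System

/-! ### The composite Lyapunov function -/

theorem exists_seminorm_comp_le {E : Type*} [AddCommGroup E] [Module ℝ E] [FiniteDimensional ℝ E]
    (p : Seminorm ℝ E) (hp : ∀ x, p x = 0 → x = 0) (L : E →ₗ[ℝ] E) :
    ∃ C : ℝ, ∀ x, p (L x) ≤ C * p x := by
  let : Norm E := ⟨p⟩
  have core : NormedSpace.Core ℝ E :=
    { norm_nonneg := fun x => apply_nonneg p x
      norm_smul := fun c x => map_smul_eq_mul p c x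
      norm_triangle := fun x y => map_add_le_add p x y
      norm_eq_zero_iff := fun x => ⟨hp x, fun h => by rw [h]; exact map_zero p⟩ }
  let := NormedAddCommGroup.ofCore core
  let := NormedSpace.ofCore core
  exact ⟨‖LinearMap.toContinuousLinearMap L‖, (LinearMap.toContinuousLinearMap L).le_opNorm⟩

section Composite

variable {N : ℕ} {n : Fin N → ℕ}

/-- Keeping only the `i`th block is a linear endomorphism of a finite-dimensional normed space,
hence bounded. -/
theorem exists_blockNrm_le (p : Seminorm ℝ (State n)) (hp : ∀ x, p x = 0 → x = 0) :
    ∃ C : ℝ≥0, 0 < C ∧ ∀ i (ξ : State n), blockNrm p i (ξ i) ≤ C * nrm p ξ := by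
  choose C hC using fun i : Fin N => exists_seminorm_comp_le p hp
    ((LinearMap.single ℝ (fun i => Fin (n i) → ℝ) i).comp (LinearMap.proj i))
  obtain ⟨B, hB⟩ := Finite.exists_le C
  refine ⟨(max B 1).toNNReal, Real.toNNReal_pos.2 (lt_max_of_lt_right one_pos), fun i ξ => ?_⟩
  rw [← NNReal.coe_le_coe, NNReal.coe_mul,
    Real.coe_toNNReal _ (zero_le_one.trans (le_max_right _ _))]
  exact (hC i ξ).trans (mul_le_mul_of_nonneg_right ((hB i).trans (le_max_left _ _))
    (apply_nonneg p ξ))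

theorem nrm_le_sum_blockNrm (p : Seminorm ℝ (State n)) (ξ : State n) :
    nrm p ξ ≤ ∑ i, blockNrm p i (ξ i) := by
  rw [← NNReal.coe_le_coe, NNReal.coe_sum]
  have h := Finset.le_sum_of_subadditive p (map_zero p).le (map_add_le_add p) Finset.univ
    (fun i => (Pi.single i (ξ i) : State n))
  rw [Finset.univ_sum_single] at h
  exact h

/-- The maximum of proper and positive definite functions of the components is proper and positive
definite. -/
theorem isProperPosDef_sup (p : Seminorm ℝ (State n)) (hp : ∀ x, p x = 0 → x = 0)
    {W : (i : Fin N) → (Fin (n i) → ℝ) → ℝ≥0} (hW : ∀ i, IsProperPosDef (blockNrm p i) (W i)) :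
    IsProperPosDef (nrm p) fun ξ => Finset.univ.sup fun i => W i (ξ i) := by
  choose α₁ α₂ h₁ h₂ hα using hW
  obtain ⟨C, hC, hblock⟩ := exists_blockNrm_le p hp
  obtain ⟨a, ha, -, hab⟩ := exists_isClassKInf_between Finset.univ isWeakK_zero
    (fun i _ => h₁ i) (fun i _ x hx => (h₁ i).pos hx)
  have hN : (0 : ℝ≥0) < (N + 1 : ℝ≥0)⁻¹ := by positivity
  refine ⟨_, _, ha.comp (isClassKInf_mul hN), isClassKInf_id.add_weak
    (IsWeakK.finsetSup Finset.univ fun i => ((h₂ i).comp (isClassKInf_mul hC)).weak),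
    fun ξ => ⟨?_, ?_⟩⟩
  · rcases eq_or_ne (nrm p ξ) 0 with h0 | h0
    · rw [h0, mul_zero, ha.zero]
      exact zero_le
    -- The blocks sum to at least the whole norm, so one carries the fraction `1 / (N + 1)`; taking
    -- `N + 1` instead of `N` also covers `N = 0`.
    obtain ⟨i, hi⟩ : ∃ i, (N + 1 : ℝ≥0)⁻¹ * nrm p ξ ≤ blockNrm p i (ξ i) := by
      by_contra! hcon
      refine lt_irrefl (nrm p ξ) ?_
      calc nrm p ξ ≤ ∑ i, blockNrm p i (ξ i) := nrm_le_sum_blockNrm p ξ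
        _ ≤ ∑ _i : Fin N, (N + 1 : ℝ≥0)⁻¹ * nrm p ξ := Finset.sum_le_sum fun i _ => (hcon i).le
        _ = N * ((N + 1 : ℝ≥0)⁻¹ * nrm p ξ) := by simp
        _ < (N + 1) * ((N + 1 : ℝ≥0)⁻¹ * nrm p ξ) :=
          mul_lt_mul_of_pos_right (lt_add_one _) (mul_pos hN (pos_iff_ne_zero.2 h0))
        _ = nrm p ξ := mul_inv_cancel_left₀ (by positivity) _
    calc a ((N + 1 : ℝ≥0)⁻¹ * nrm p ξ) ≤ a (blockNrm p i (ξ i)) := ha.weak.mono hi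
      _ ≤ α₁ i (blockNrm p i (ξ i)) := hab i (Finset.mem_univ i) _
      _ ≤ W i (ξ i) := (hα i _).1
      _ ≤ _ := Finset.le_sup (f := fun i => W i (ξ i)) (Finset.mem_univ i)
  · refine le_trans (Finset.sup_mono_fun fun i _ => ?_) le_add_self
    exact (hα i _).2.trans ((h₂ i).weak.mono (hblock i ξ))

theorem IsProperPosDef.comp {E : Type*} {size W : E → ℝ≥0} (hW : IsProperPosDef size W)
    {θ : ℝ≥0 → ℝ≥0} (hθ : IsClassKInf θ) : IsProperPosDef size fun x => θ (W x) := by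
  obtain ⟨α₁, α₂, h₁, h₂, h⟩ := hW
  exact ⟨_, _, hθ.comp h₁, hθ.comp h₂, fun ξ =>
    ⟨hθ.weak.mono (h ξ).1, hθ.weak.mono (h ξ).2⟩⟩

/-- Either `b ≤ δ a` or `a ≤ δ⁻¹ b`. This trades the sum of gain and input for a maximum, at the
price of the factor `id + δ`. -/
theorem add_le_max_idAdd {δ : ℝ≥0 → ℝ≥0} (hδ : IsClassKInf δ) (a b : ℝ≥0) :
    a + b ≤ max (idAdd δ a) (idAdd (inv δ) b) := by
  rcases le_total b (δ a) with h | h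
  · exact le_max_of_le_left (add_le_add le_rfl h)
  · refine le_max_of_le_right ?_
    rw [add_comm]
    refine add_le_add le_rfl ?_
    rw [← hδ.strictMono.le_iff_le, hδ.apply_inv]
    exact h

theorem weak_of_classK_or_zero {α : ℝ≥0 → ℝ≥0} (h : IsClassK α ∨ α = 0) : IsWeakK α := by
  rcases h with h | rfl
  exacts [h.weak, isWeakK_zero]

/-- The composite function decreases along an `Ω`-path up to the input, in maximum form. -/
theorem compositeLyapunov_le_max {δ₁ δ₂ : Fin N → ℝ≥0 → ℝ≥0} (hδ₁ : ∀ i, IsClassKInf (δ₁ i))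
    (hδ₂ : ∀ i, IsClassKInf (δ₂ i)) {γ : Fin N → Fin N → ℝ≥0 → ℝ≥0}
    (hγ : ∀ i j, IsClassKInf (γ i j) ∨ γ i j = 0) {σ : Fin N → ℝ≥0 → ℝ≥0}
    (hσ : IsOmegaPath (diagOp δ₁ ∘ gainMap γ ∘ diagOp δ₂) σ)
    {V : (i : Fin N) → (Fin (n i) → ℝ) → ℝ≥0} {ξ ζ : State n} {c : Fin N → ℝ≥0}
    (h : ∀ i, V i (ζ i) ≤ gainMap γ (fun j => V j (ξ j)) i + c i) :
    compositeLyapunov σ δ₂ V ζ ≤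
      max (Finset.univ.sup fun i => inv (σ i) (inv (idAdd (δ₂ i))
          (σ i (compositeLyapunov σ δ₂ V ξ))))
        (Finset.univ.sup fun i => inv (σ i) (inv (idAdd (δ₂ i)) (idAdd (inv (δ₁ i)) (c i)))) := by
  set r := compositeLyapunov σ δ₂ V ξ with hr
  have hθ : ∀ i, IsClassKInf fun x => inv (σ i) (inv (idAdd (δ₂ i)) x) := fun i =>
    (hσ.classKInf i).inv.comp (hδ₂ i).idAdd.inv
  have hVr : ∀ j, V j (ξ j) ≤ idAdd (δ₂ j) (σ j r) := fun j => by
    rw [← (hθ j).strictMono.le_iff_le]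
    simp only [(hδ₂ j).idAdd.inv_apply, (hσ.classKInf j).inv_apply]
    exact Finset.le_sup (f := fun i => inv (σ i) (inv (idAdd (δ₂ i)) (V i (ξ i))))
      (Finset.mem_univ j)
  -- The factor `id + δ₁` lost in passing to the maximum is part of the map that the path decreases.
  have hgain : ∀ i, idAdd (δ₁ i) (gainMap γ (fun j => V j (ξ j)) i) ≤ σ i r := fun i => by
    have h1 : idAdd (δ₁ i) (gainMap γ (fun j => V j (ξ j)) i) ≤
        (diagOp δ₁ ∘ gainMap γ ∘ diagOp δ₂) (fun j => σ j r) i :=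
      (hδ₁ i).idAdd.weak.mono (Finset.sup_mono_fun fun j _ =>
        (weak_of_classKInf_or_zero (hγ i j)).mono (hVr j))
    refine h1.trans ?_
    rcases eq_or_ne r 0 with h0 | h0
    · rw [diagOp_gainMap_diagOp γ hδ₁]
      refine Finset.sup_le fun j _ => ?_
      rw [h0, (hσ.classKInf j).zero, (hδ₂ j).idAdd.zero,
        (weak_of_classKInf_or_zero (hγ i j)).zero, (hδ₁ i).idAdd.zero]
      exact zero_le
    · exact (hσ.decay r (pos_iff_ne_zero.2 h0) i).le
  refine Finset.sup_le fun i _ => ?_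
  have h2 := (hθ i).weak.mono ((h i).trans ((add_le_max_idAdd (hδ₁ i) _ _).trans
    (max_le_max (hgain i) le_rfl)))
  rw [(hθ i).weak.map_max] at h2
  refine h2.trans (max_le_max ?_ ?_)
  · exact Finset.le_sup (f := fun i => inv (σ i) (inv (idAdd (δ₂ i)) (σ i r))) (Finset.mem_univ i)
  · exact Finset.le_sup (f := fun i => inv (σ i) (inv (idAdd (δ₂ i)) (idAdd (inv (δ₁ i)) (c i))))
      (Finset.mem_univ i)

/-- The maximum of `id / 2` and finitely many functions of class `K∞` whose differences to the
identity are of class `K∞` is again such a function. -/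
theorem exists_isClassKInf_add_eq_id {τ : Fin N → ℝ≥0 → ℝ≥0} (hτ : ∀ i, IsClassKInf (τ i))
    (h : ∀ i, ∃ α, IsClassKInf α ∧ ∀ s, τ i s + α s = s) :
    ∃ ρ α, IsClassKInf ρ ∧ IsClassKInf α ∧ (∀ s, ρ s + α s = s) ∧ ∀ i s, τ i s ≤ ρ s := by
  suffices H : ∀ S : Finset (Fin N), ∃ ρ α, IsClassKInf ρ ∧ IsClassKInf α ∧
      (∀ s, ρ s + α s = s) ∧ ∀ i ∈ S, ∀ s, τ i s ≤ ρ s by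
    obtain ⟨ρ, α, h₁, h₂, h₃, h₄⟩ := H Finset.univ
    exact ⟨ρ, α, h₁, h₂, h₃, fun i => h₄ i (Finset.mem_univ i)⟩
  intro S
  induction S using Finset.induction_on with
  | empty =>
    have h2 : IsClassKInf fun r : ℝ≥0 => 2⁻¹ * r := isClassKInf_mul (by norm_num)
    refine ⟨_, _, h2, h2, fun s => ?_, by simp⟩
    rw [← add_mul, ← two_mul, mul_inv_cancel₀ two_ne_zero, one_mul]
  | insert i S _ ih =>
    obtain ⟨ρ, α, h₁, h₂, h₃, h₄⟩ := ih
    obtain ⟨α', h₅, h₆⟩ := h i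
    -- The complement to the identity of a maximum is the minimum of the complements.
    refine ⟨_, _, h₁.max (hτ i), h₂.min h₅, fun s => ?_, fun k hk s => ?_⟩
    · have e1 := h₃ s
      have e2 := h₆ s
      rcases le_total (ρ s) (τ i s) with hle | hle
      · rw [max_eq_right hle, min_eq_right, e2]
        exact le_of_add_le_add_left (a := ρ s)
          ((add_le_add hle le_rfl).trans (e2.trans e1.symm).le)
      · rw [max_eq_left hle, min_eq_left, e1]
        exact le_of_add_le_add_left (a := τ i s)
          ((add_le_add hle le_rfl).trans (e1.trans e2.symm).le)
    · rcases Finset.mem_insert.1 hk with rfl | hk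
      · exact le_max_right _ _
      · exact le_max_of_le_left (h₄ k hk s)

end Composite

end FiniteStepISS

/-! ### Assembly of the theorem -/

theorem mainTheorem2
    {N m : ℕ} {n : Fin N → ℕ}
    -- the norms on the state space and on the input space
    (pX : Seminorm ℝ (State n)) (hpX : IsMonotonicNorm pX)
    (pU : Seminorm ℝ (Fin m → ℝ)) (hpU : IsMonotonicNorm pU)
    -- the subsystems
    (g : (i : Fin N) → State n → (Fin m → ℝ) → Fin (n i) → ℝ)
    (hG : GloballyKBounded pX pU (overall g))
    -- the diagonal operators and the factorization `D = D₂ ∘ D₁`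
    (δ δ₁ δ₂ : Fin N → ℝ≥0 → ℝ≥0)
    (hδ : ∀ i, IsClassKInf (δ i)) (hδ₁ : ∀ i, IsClassKInf (δ₁ i)) (hδ₂ : ∀ i, IsClassKInf (δ₂ i))
    (hD : diagOp δ = diagOp δ₂ ∘ diagOp δ₁)
    -- the Lyapunov-type functions and the gains
    (M : ℕ) (hM : 1 ≤ M)
    (V : (i : Fin N) → (Fin (n i) → ℝ) → ℝ≥0)
    (γ : Fin N → Fin N → ℝ≥0 → ℝ≥0) (hγ : ∀ i j, IsClassKInf (γ i j) ∨ γ i j = 0)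
    (γu : Fin N → ℝ≥0 → ℝ≥0) (hγu : ∀ i, IsClassK (γu i) ∨ γu i = 0)
    (hV : ∀ i, IsProperPosDef (blockNrm pX i) (V i))
    (hdecay : ∀ (ξ : State n) (u : ℕ → Fin m → ℝ), IsBoundedInput pU u → ∀ i,
      V i (solution (overall g) ξ u M i) ≤
        gainMap γ (fun j => V j (ξ j)) i + γu i (supNrm pU u))
    (hsg : NotGeId (diagOp δ ∘ gainMap γ)) :
    (∃ σ : Fin N → ℝ≥0 → ℝ≥0, IsOmegaPath (diagOp δ₁ ∘ gainMap γ ∘ diagOp δ₂) σ) ∧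
    ∀ σ : Fin N → ℝ≥0 → ℝ≥0, IsOmegaPath (diagOp δ₁ ∘ gainMap γ ∘ diagOp δ₂) σ →
      (∀ i, ∃ α : ℝ≥0 → ℝ≥0, IsClassKInf α ∧
        ∀ s, inv (σ i) (inv (idAdd (δ₂ i)) (σ i s)) + α s = s) →
      IsDissipativeFiniteStepISSLyapunov pX pU (overall g) (compositeLyapunov σ δ₂ V) ∧
      IsISS pX pU (overall g) := by
  refine ⟨exists_isOmegaPath_of_strong_smallGain hδ₁ hδ₂ hD hγ hsg, fun σ hσ hα => ?_⟩
  have hθ : ∀ i, IsClassKInf fun x => inv (σ i) (inv (idAdd (δ₂ i)) x) := fun i =>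
    (hσ.classKInf i).inv.comp (hδ₂ i).idAdd.inv
  obtain ⟨ρ, α, hρ, hα, hρα, hle⟩ :=
    exists_isClassKInf_add_eq_id (fun i => (hθ i).comp (hσ.classKInf i)) hα
  have hproper : IsProperPosDef (nrm pX) (compositeLyapunov σ δ₂ V) :=
    isProperPosDef_sup pX hpX.definite fun i => (hV i).comp (hθ i)
  have hη : IsWeakK fun s => Finset.univ.sup fun i =>
      inv (σ i) (inv (idAdd (δ₂ i)) (idAdd (inv (δ₁ i)) (γu i s))) :=
    IsWeakK.finsetSup _ fun i => (hθ i).weak.comp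
      ((hδ₁ i).inv.idAdd.weak.comp (weak_of_classK_or_zero (hγu i)))
  have hdec := fun ξ u hu => (compositeLyapunov_le_max hδ₁ hδ₂ hγ hσ (hdecay ξ u hu)).trans
    (max_le_max (Finset.sup_le fun i _ => hle i _) le_rfl)
  -- The input gain `η` may vanish identically; adding the identity makes it of class `K`. ISS is
  -- drawn from the sharper maximum form `hdec`, not from the dissipative sum.
  refine ⟨⟨hproper, M, _, ρ, hM, isClassKInf_id.toIsClassK.add_weak hη,
    ⟨hρ.cont, hρ.zero, fun s hs => hρ.pos hs⟩, ⟨α, hα, hρα⟩, fun ξ u hu => ?_⟩,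
    isISS_of_finiteStep_max hG hproper hM hρ.weak (fun r hr => ?_) hη hdec⟩
  · refine (hdec ξ u hu).trans ((max_le_add_of_nonneg zero_le zero_le).trans ?_)
    exact add_le_add le_rfl le_add_self
  · calc ρ r < ρ r + α r := lt_add_of_pos_right _ (hα.pos hr)
      _ = r := hρα r
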